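/- An $O(N)^3$-invariant (tetrahedral) graph is a finite graph $G$ with edges colored by $\{0,1,2,3\}$ (parallel edges allowed, no loops), in which every vertex is incident to exactly one edge of each color, and in which every connected component of the subgraph of colors $1,2,3$ is a tetrahedral bubble, i.e. a complete graph on four vertices in which opposite edges have the same color. A face of color $i\in\{1,2,3\}$ is a cycle of colors $\{0,i\}$, and its length is the number of its edges of color $0$. The jacket $J_i$ is $G$ with the edges of color $i$ deleted; its faces are all its bicolored cycles, and its genus $g_i\in\frac12\mathbb Z$ is defined for connected $G$ by $2-2g_i=V(J_i)-E(J_i)+F(J_i)$. The degree of $G$ is $\omega(G)=g_1+g_2+g_3$. The graph $G$ is 2PI (2-particle-irreducible) if there are no two distinct edges of color $0$ whose removal disconnects $G$, and dipole-free if no face of length two passes through two distinct bubbles. Let $G_{\mathrm{oct}}$ be the following graph with six bubbles. Its vertices are the $24$ ordered pairs $(p,q)$ of adjacent vertices of the octahedron with vertices $\pm e_1,\pm e_2,\pm e_3$. The edges of color $0$ join $(p,q)$ to $(q,p)$; those of color $3$ join $(p,q)$ to $(p,-q)$; those of color $1$ (respectively $2$) join $(p,q)$ to $(p,r)$, where $p,q,r$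 are the corners of a face of the octahedron and the product of their three signs is $+1$ (respectively $-1$). Theorem. The graph $G_{\mathrm{oct}}$ is connected, 2PI, dipole-free and of degree $1$. Conversely, every connected, 2PI, dipole-free $O(N)^3$-invariant graph of degree $1$ is isomorphic to $G_{\mathrm{oct}}$, up to a permutation of the colors $1,2,3$. -/

import Mathlib

universe u v

/-- A finite `O(N)³`-invariant Feynman graph with tetrahedral interactions, on the vertex set `V`.
Every vertex has exactly one half-edge of each color `0, 1, 2, 3`, so a color `c` is a
fixed-point-free involution `nbr c` that sends a vertex to the other end of its edge of color `c`
(edges of different colors may be parallel). Color `0` is the propagator. The condition `tetra`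
says that the four vertices `v`, `nbr 1 v`, `nbr 2 v`, `nbr 3 v` carry the tetrahedral bubble:
the complete graph on four vertices, opposite edges having the same color. -/
structure TetraGraph (V : Type u) where
  nbr : Fin 4 → V → V
  nbr_nbr : ∀ c x, nbr c (nbr c x) = x
  nbr_ne : ∀ c x, nbr c x ≠ x
  tetra : ∀ x, nbr 1 (nbr 2 x) = nbr 3 x

namespace TetraGraph

variable {V : Type u} {W : Type v}

/-- The adjacency relation of the graph that keeps only the edges with colors in `S`. -/
def keep (G : TetraGraph V) (S : Finset (Fin 4)) : SimpleGraph V where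
  Adj x y := ∃ c ∈ S, G.nbr c x = y
  symm := ⟨by
    rintro x y ⟨c, hc, rfl⟩
    exact ⟨c, hc, G.nbr_nbr c x⟩⟩
  loopless := ⟨by
    rintro x ⟨c, -, h⟩
    exact G.nbr_ne c x h⟩

/-- The graph is connected (in particular it has a vertex). -/
def IsConnected (G : TetraGraph V) : Prop := (G.keep Finset.univ).Connected

/-- The edges of color `c`, as unordered pairs of vertices. -/
def edges (G : TetraGraph V) (c : Fin 4) : Set (Sym2 V) :=
  Set.range fun x => s(x, G.nbr c x)

/-- The bubbles: connected components of the graph without the edges of color `0`. -/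
abbrev Bubble (G : TetraGraph V) : Type u := (G.keep {1, 2, 3}).ConnectedComponent

/-- The bubble that contains a vertex. -/
def bubble (G : TetraGraph V) (x : V) : G.Bubble := (G.keep {1, 2, 3}).connectedComponentMk x

/-- The faces of color `i` (for `i ≠ 0`): bicolored cycles with colors `0` and `i`. -/
abbrev Face (G : TetraGraph V) (i : Fin 4) : Type u := (G.keep {0, i}).ConnectedComponent

/-- The length of a face: the number of its edges of color `0`. -/
noncomputable def faceLength (G : TetraGraph V) {i : Fin 4} (f : G.Face i) : ℕ :=
  {e ∈ G.edges 0 | ∀ x ∈ e, x ∈ f.supp}.ncard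

/-- The number of edges of the jacket `J i`, in which the edges of color `i` are deleted. -/
noncomputable def jacketEdges (G : TetraGraph V) (i : Fin 4) : ℕ :=
  ∑ c ∈ Finset.univ.erase i, (G.edges c).ncard

/-- The number of faces of the jacket `J i`: the bicolored cycles for the three pairs of colors
other than `i`. -/
noncomputable def jacketFaces (G : TetraGraph V) (i : Fin 4) : ℕ :=
  ∑ S ∈ (Finset.univ.erase i).powersetCard 2, Nat.card (G.keep S).ConnectedComponent

/-- The (possibly half-integral) genus `g` of the jacket `J i`, given by Euler's formula
`2 - 2 g = V - E + F`. -/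
noncomputable def jacketGenus (G : TetraGraph V) (i : Fin 4) : ℚ :=
  (2 - ((Nat.card V : ℚ) - G.jacketEdges i + G.jacketFaces i)) / 2

/-- The degree: the sum of the genera of the three jackets. -/
noncomputable def degree (G : TetraGraph V) : ℚ :=
  G.jacketGenus 1 + G.jacketGenus 2 + G.jacketGenus 3

/-- The graph that is left when the edges of color `0` in `T` are removed. -/
def cut (G : TetraGraph V) (T : Set (Sym2 V)) : SimpleGraph V where
  Adj x y := ∃ c, G.nbr c x = y ∧ ¬ (c = 0 ∧ s(x, y) ∈ T)
  symm := ⟨by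
    rintro x y ⟨c, rfl, h⟩
    exact ⟨c, G.nbr_nbr c x, by rwa [Sym2.eq_swap]⟩⟩
  loopless := ⟨by
    rintro x ⟨c, h, -⟩
    exact G.nbr_ne c x h⟩

/-- 2-particle-irreducible: there is no pair of edges of color `0` whose removal disconnects the
graph. -/
def Is2PI (G : TetraGraph V) : Prop :=
  ∀ e ∈ G.edges 0, ∀ e' ∈ G.edges 0, e ≠ e' → (G.cut {e, e'}).Connected

/-- A dipole of color `i`: two distinct bubbles with a common face of color `i` and length two. -/
def HasDipole (G : TetraGraph V) (i : Fin 4) : Prop :=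
  ∃ f : G.Face i, G.faceLength f = 2 ∧ ∃ x ∈ f.supp, ∃ y ∈ f.supp,
    G.bubble x ≠ G.bubble y

/-- The graph has no dipole of any of the colors `1, 2, 3`. -/
def DipoleFree (G : TetraGraph V) : Prop := ∀ i, i ≠ 0 → ¬ G.HasDipole i

/-- The two graphs are the same up to the names of the vertices and a permutation of the colors
`1, 2, 3`. -/
def SameUpToColors (G : TetraGraph V) (H : TetraGraph W) : Prop :=
  ∃ (φ : V ≃ W) (π : Equiv.Perm (Fin 4)), π 0 = 0 ∧
    ∀ c x, φ (G.nbr c x) = H.nbr (π c) (φ x)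

end TetraGraph

/-- A vertex of the octahedron: the unit vector `(-1) ^ s • e a` is the pair `(a, s)`. -/
abbrev OctVertex : Type := ZMod 3 × ZMod 2

/-- The pairs of adjacent vertices of the octahedron: `(p, q)` is the half-edge at `p` that points
to `q`. -/
abbrev OctHalfEdge : Type := {h : OctVertex × OctVertex // h.1.1 ≠ h.2.1}

/-- The third corner `r` of the face of the octahedron that contains `p` and `q` and whose three
signs have the product `(-1) ^ t`; the axes of `p`, `q`, `r` are the three elements of `ZMod 3`,
whose sum is `0`. -/
def octThird (t : ZMod 2) (p q : OctVertex) : OctVertex :=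
  (-p.1 - q.1, t - p.2 - q.2)

/-- The graph with six bubbles, one at each vertex `p` of the octahedron, with the four half-edges
`(p, q)` as its vertices. An edge of color `0` joins `(p, q)` to `(q, p)`. At the bubble `p`, color
`1` joins two half-edges that span a positive face of the octahedron, color `2` joins two that span
a negative face, and color `3` joins two opposite ones. The jacket `J 3` is thus drawn on the
sphere as the octahedron whose vertices are blown up to squares, and its faces of colors `1` and
`2` are the eight triangles, in checkerboard coloring. -/
def octahedralGraph : TetraGraph OctHalfEdge where
  nbr := ![
    fun h => ⟨(h.1.2, h.1.1), h.2.symm⟩,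
    fun h => ⟨(h.1.1, octThird 0 h.1.1 h.1.2), by revert h; decide +kernel⟩,
    fun h => ⟨(h.1.1, octThird 1 h.1.1 h.1.2), by revert h; decide +kernel⟩,
    fun h => ⟨(h.1.1, (h.1.2.1, h.1.2.2 + 1)), h.2⟩]
  nbr_nbr := by decide +kernel
  nbr_ne := by decide +kernel
  tetra := by decide +kernel

/-!
Let `G` be connected, 2PI, dipole-free and of degree one, with `n` bubbles. Euler's formula gives
`2 g k = 2 + n - F i - F j`, where `F c` is the number of faces of color `c`. The genera are
half-integers `≥ 0`, because the boundaries of the faces of `J k` span a subspace of dimension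
`F i + F j - 1` of the cycle space over `𝔽₂`, of dimension `n + 1`. As they add up to `1`, some
jacket `J k` is planar, and then `2 F k = n`: the faces of color `k`, which run through each bubble
twice, have average length four.

Since `J k` is planar, the boundaries of its faces span the cycle space, which makes the loops, the
faces of color `k`, behave like closed curves on the sphere: a loop crosses any other one, or a
cycle that shares no edge with it, an even number of times. As a loop runs twice through its
self-crossings, its length is even. Lengths less than three are excluded because `G` is 2PI and
dipole-free, so that all loops have length four. If such a loop crosses itself at a bubble, it
leaves from there to a bubble from which it comes straight back; a different loop would cross the
cycle formed by these two edges only once, so that the loop also crosses itself at the second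
bubble. By connectedness a self-crossing would thus imply that there is only one loop. Hence a loop
crosses others only, each of them at least twice, and one that crosses two others crosses no third.
As `F i + F j = n + 2`, some face of color `i` or `j` is a triangle; the three loops through it
cross each other, hence no other loop, so that `n = 6` and all faces of colors `i` and `j` are
triangles.

In a graph whose faces of colors `i` and `j` are triangles, the involutions `nbr i`, `nbr 0` and
`nbr j` satisfy the Coxeter relations of type `A₃`. The orbit of a pair of vertices under their
diagonal action on `G × G_oct` has therefore at most `24` elements, as many as `G` and `G_oct` have
vertices, and is the graph of an isomorphism.
-/

namespace TetraGraph

variable {V : Type u} {W : Type v} {i j k : Fin 4}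

theorem mem_of_reachable {H : SimpleGraph V} {T : Set V}
    (hT : ∀ x ∈ T, ∀ y, H.Adj x y → y ∈ T) {x y : V} (h : H.Reachable x y) (hx : x ∈ T) :
    y ∈ T := by
  obtain ⟨p⟩ := h
  induction p with
  | nil => exact hx
  | cons hadj _ ih => exact ih (hT _ hx _ hadj)

theorem mem_of_mk_eq_mk (G : TetraGraph V) {S : Finset (Fin 4)} {T : Set V}
    (hT : ∀ c ∈ S, ∀ x ∈ T, G.nbr c x ∈ T) {x y : V} (hx : x ∈ T)
    (h : (G.keep S).connectedComponentMk y = (G.keep S).connectedComponentMk x) : y ∈ T := by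
  refine mem_of_reachable (H := G.keep S) ?_ (SimpleGraph.ConnectedComponent.exact h.symm) hx
  rintro x hx y ⟨c, hc, rfl⟩
  exact hT c hc x hx

theorem IsConnected.mem {G : TetraGraph V} (hG : G.IsConnected) {T : Set V}
    (hT : ∀ c, ∀ x ∈ T, G.nbr c x ∈ T) {x : V} (hx : x ∈ T) (y : V) : y ∈ T :=
  G.mem_of_mk_eq_mk (S := Finset.univ) (fun c _ => hT c) hx
    (SimpleGraph.ConnectedComponent.sound (hG.preconnected y x))

theorem mk_nbr (G : TetraGraph V) {S : Finset (Fin 4)} {c : Fin 4} (hc : c ∈ S) (x : V) :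
    (G.keep S).connectedComponentMk (G.nbr c x) = (G.keep S).connectedComponentMk x :=
  SimpleGraph.ConnectedComponent.connectedComponentMk_eq_of_adj ⟨c, hc, G.nbr_nbr c x⟩

theorem nbr_injective (G : TetraGraph V) (c : Fin 4) : Function.Injective (G.nbr c) :=
  Function.LeftInverse.injective (G.nbr_nbr c)

theorem nbr_eq_iff (G : TetraGraph V) {c : Fin 4} {x y : V} : G.nbr c x = y ↔ x = G.nbr c y :=
  ⟨fun h => by rw [← h, G.nbr_nbr], fun h => by rw [h, G.nbr_nbr]⟩

/-- `i`, `j`, `k` are the colors `1`, `2`, `3` in some order. -/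
structure IsColorTriple (i j k : Fin 4) : Prop where
  fst_ne_zero : i ≠ 0
  snd_ne_zero : j ≠ 0
  thd_ne_zero : k ≠ 0
  fst_ne_snd : i ≠ j
  fst_ne_thd : i ≠ k
  snd_ne_thd : j ≠ k

theorem isColorTriple_one_two_three : IsColorTriple 1 2 3 := by constructor <;> decide

namespace IsColorTriple

theorem rotate (h : IsColorTriple i j k) : IsColorTriple j k i :=
  ⟨h.snd_ne_zero, h.thd_ne_zero, h.fst_ne_zero, h.snd_ne_thd, h.fst_ne_snd.symm, h.fst_ne_thd.symm⟩

theorem swap (h : IsColorTriple i j k) : IsColorTriple j i k :=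
  ⟨h.snd_ne_zero, h.fst_ne_zero, h.thd_ne_zero, h.fst_ne_snd.symm, h.snd_ne_thd, h.fst_ne_thd⟩

theorem exists_of_ne (hi : i ≠ 0) (hj : j ≠ 0) (hij : i ≠ j) : ∃ k, IsColorTriple i j k := by
  suffices ∃ k : Fin 4, k ≠ 0 ∧ i ≠ k ∧ j ≠ k from
    this.imp fun k ⟨hk, hik, hjk⟩ => ⟨hi, hj, hk, hij, hik, hjk⟩
  revert i j; decide

theorem exists_of_ne_zero (hi : i ≠ 0) : ∃ j k, IsColorTriple i j k := by
  obtain ⟨j, hj, hij⟩ : ∃ j : Fin 4, j ≠ 0 ∧ i ≠ j := by revert i; decide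
  exact ⟨j, exists_of_ne hi hj hij⟩

theorem eq_or (h : IsColorTriple i j k) (c : Fin 4) : c = 0 ∨ c = i ∨ c = j ∨ c = k := by
  obtain ⟨hi, hj, hk, hij, hik, hjk⟩ := h
  revert i j k c; decide

theorem cases (h : IsColorTriple i j k) :
    (i = 1 ∧ j = 2 ∧ k = 3) ∨ (i = 2 ∧ j = 1 ∧ k = 3) ∨ (i = 1 ∧ j = 3 ∧ k = 2) ∨
    (i = 2 ∧ j = 3 ∧ k = 1) ∨ (i = 3 ∧ j = 1 ∧ k = 2) ∨ (i = 3 ∧ j = 2 ∧ k = 1) := by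
  obtain ⟨hi, hj, hk, hij, hik, hjk⟩ := h
  grind

end IsColorTriple

theorem nbr_mul (G : TetraGraph V) (h : IsColorTriple i j k) (x : V) :
    G.nbr i (G.nbr j x) = G.nbr k x := by
  have swap {i j k} (h : ∀ x, G.nbr i (G.nbr j x) = G.nbr k x) (x : V) :
      G.nbr j (G.nbr i x) = G.nbr k x := by
    rw [G.nbr_eq_iff, G.nbr_eq_iff, h, G.nbr_nbr]
  have rotate {i j k} (h : ∀ x, G.nbr i (G.nbr j x) = G.nbr k x) (x : V) :
      G.nbr j (G.nbr k x) = G.nbr i x := by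
    rw [← swap h, G.nbr_nbr]
  have h123 := G.tetra
  rcases h.cases with ⟨rfl, rfl, rfl⟩ | ⟨rfl, rfl, rfl⟩ | ⟨rfl, rfl, rfl⟩ | ⟨rfl, rfl, rfl⟩ |
    ⟨rfl, rfl, rfl⟩ | ⟨rfl, rfl, rfl⟩
  exacts [h123 x, swap h123 x, swap (rotate (rotate h123)) x, rotate h123 x,
    rotate (rotate h123) x, swap (rotate h123) x]

theorem nbr_ne_nbr (G : TetraGraph V) (hi : i ≠ 0) (hj : j ≠ 0) (hij : i ≠ j) (x : V) :
    G.nbr i x ≠ G.nbr j x := by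
  obtain ⟨k, h⟩ := IsColorTriple.exists_of_ne hj hi hij.symm
  rw [Ne, eq_comm, G.nbr_eq_iff, G.nbr_mul h]
  exact (G.nbr_ne k x).symm

/-! ### Counting edges, bubbles and faces -/

theorem ncard_eq_mul_ncard_image {α β : Type*} [Finite α] (S : Set α) (f : α → β) (m : ℕ)
    (h : ∀ x ∈ S, {y ∈ S | f y = f x}.ncard = m) : S.ncard = m * (f '' S).ncard := by
  classical
  have := Fintype.ofFinite α
  rw [← Set.coe_toFinset S, ← Finset.coe_image, Set.ncard_coe_finset, Set.ncard_coe_finset,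
    Finset.card_eq_sum_card_image f, Finset.sum_const_nat (m := m), mul_comm]
  intro b hb
  obtain ⟨x, hx, rfl⟩ := Finset.mem_image.1 hb
  rw [← h x (Set.mem_toFinset.1 hx), ← Set.ncard_coe_finset]
  congr 1
  ext y
  simp

theorem card_eq_mul_card_component [Finite V] (H : SimpleGraph V) (m : ℕ)
    (h : ∀ C : H.ConnectedComponent, C.supp.ncard = m) :
    Nat.card V = m * Nat.card H.ConnectedComponent := by
  have := ncard_eq_mul_ncard_image Set.univ H.connectedComponentMk m fun x _ => by
    rw [← h (H.connectedComponentMk x)]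
    congr 1
    ext y
    simp
  rwa [Set.image_univ, Set.range_eq_univ.2 fun C => C.exists_rep, Set.ncard_univ,
    Set.ncard_univ] at this

theorem two_mul_ncard_edges_within [Finite V] (G : TetraGraph V) {c : Fin 4} {S : Set V}
    (hS : ∀ x ∈ S, G.nbr c x ∈ S) : 2 * {e ∈ G.edges c | ∀ x ∈ e, x ∈ S}.ncard = S.ncard := by
  have himage : {e ∈ G.edges c | ∀ x ∈ e, x ∈ S} = (fun x => s(x, G.nbr c x)) '' S := by
    ext e
    constructor
    · rintro ⟨⟨x, rfl⟩, hx⟩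
      exact ⟨x, hx x (Sym2.mem_mk_left _ _), rfl⟩
    · rintro ⟨x, hx, rfl⟩
      refine ⟨⟨x, rfl⟩, fun y hy => ?_⟩
      rcases Sym2.mem_iff.1 hy with rfl | rfl
      exacts [hx, hS x hx]
  rw [himage, ← ncard_eq_mul_ncard_image]
  intro x hx
  rw [← Set.ncard_pair (G.nbr_ne c x).symm]
  congr 1
  ext y
  simp only [Sym2.eq_iff, Set.mem_ofPred_eq, Set.mem_insert_iff, Set.mem_singleton_iff]
  constructor
  · rintro ⟨-, h | h⟩
    exacts [Or.inl h.1, Or.inr h.1]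
  · rintro (rfl | rfl)
    exacts [⟨hx, Or.inl ⟨rfl, rfl⟩⟩, ⟨hS x hx, Or.inr ⟨rfl, G.nbr_nbr c x⟩⟩]

theorem two_mul_ncard_edges [Finite V] (G : TetraGraph V) (c : Fin 4) :
    2 * (G.edges c).ncard = Nat.card V := by
  simpa using G.two_mul_ncard_edges_within (c := c) (S := Set.univ) (by simp)

theorem even_ncard [Finite V] (G : TetraGraph V) {c : Fin 4} {S : Set V}
    (hS : ∀ x ∈ S, G.nbr c x ∈ S) : Even S.ncard :=
  even_iff_two_dvd.2 ⟨_, (G.two_mul_ncard_edges_within hS).symm⟩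

theorem mk_eq_mk_iff (G : TetraGraph V) (h : IsColorTriple i j k) {S : Finset (Fin 4)}
    (h0 : 0 ∉ S) (hi : i ∈ S) (hj : j ∈ S) {x y : V} :
    (G.keep S).connectedComponentMk y = (G.keep S).connectedComponentMk x ↔
      y ∈ ({x, G.nbr i x, G.nbr j x, G.nbr k x} : Set V) := by
  constructor
  · refine G.mem_of_mk_eq_mk ?_ (by simp)
    rintro c hc y (rfl | rfl | rfl | rfl) <;> rcases h.eq_or c with rfl | rfl | rfl | rfl <;>
      first
      | exact absurd hc h0
      | simp [G.nbr_nbr, G.nbr_mul h, G.nbr_mul h.rotate, G.nbr_mul h.rotate.rotate,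
          G.nbr_mul h.swap, G.nbr_mul h.swap.rotate, G.nbr_mul h.swap.rotate.rotate]
  · rintro (rfl | rfl | rfl | rfl)
    · rfl
    · exact G.mk_nbr hi x
    · exact G.mk_nbr hj x
    · rw [← G.nbr_mul h, G.mk_nbr hi, G.mk_nbr hj]

theorem ncard_supp_eq_four (G : TetraGraph V) (h : IsColorTriple i j k) {S : Finset (Fin 4)}
    (h0 : 0 ∉ S) (hi : i ∈ S) (hj : j ∈ S) (C : (G.keep S).ConnectedComponent) :
    C.supp.ncard = 4 := by
  obtain ⟨x, rfl⟩ := C.exists_rep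
  have hsupp : ((G.keep S).connectedComponentMk x).supp =
      {x, G.nbr i x, G.nbr j x, G.nbr k x} := by
    ext y
    rw [SimpleGraph.ConnectedComponent.mem_supp_iff, G.mk_eq_mk_iff h h0 hi hj]
  have hij := G.nbr_ne_nbr h.fst_ne_zero h.snd_ne_zero h.fst_ne_snd x
  have hik := G.nbr_ne_nbr h.fst_ne_zero h.thd_ne_zero h.fst_ne_thd x
  have hjk := G.nbr_ne_nbr h.snd_ne_zero h.thd_ne_zero h.snd_ne_thd x
  change ((G.keep S).connectedComponentMk x).supp.ncard = 4
  rw [hsupp, Set.ncard_insert_of_notMem, Set.ncard_insert_of_notMem, Set.ncard_pair hjk]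
  · simp [hij, hik]
  · simp [(G.nbr_ne _ x).symm]

theorem bubble_nbr (G : TetraGraph V) {c : Fin 4} (hc : c ≠ 0) (x : V) :
    G.bubble (G.nbr c x) = G.bubble x :=
  G.mk_nbr (by revert c; decide) x

theorem bubble_eq_iff (G : TetraGraph V) (h : IsColorTriple i j k) {x y : V} :
    G.bubble y = G.bubble x ↔ y = x ∨ y = G.nbr i x ∨ y = G.nbr j x ∨ y = G.nbr k x := by
  have hmem : ∀ i : Fin 4, i ≠ 0 → i ∈ ({1, 2, 3} : Finset (Fin 4)) := by decide
  exact G.mk_eq_mk_iff h (by decide) (hmem i h.fst_ne_zero) (hmem j h.snd_ne_zero)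

theorem ncard_supp_bubble (G : TetraGraph V) (B : G.Bubble) : B.supp.ncard = 4 :=
  G.ncard_supp_eq_four isColorTriple_one_two_three (by decide) (by decide) (by decide) B

theorem card_eq_four_mul_card_bubble [Finite V] (G : TetraGraph V) :
    Nat.card V = 4 * Nat.card G.Bubble :=
  card_eq_mul_card_component _ 4 G.ncard_supp_bubble

theorem four_dvd_ncard [Finite V] (G : TetraGraph V) {S : Set V}
    (hS : ∀ c ≠ 0, ∀ x ∈ S, G.nbr c x ∈ S) : 4 ∣ S.ncard := by
  refine ⟨_, ncard_eq_mul_ncard_image S G.bubble 4 fun x hx => ?_⟩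
  rw [← G.ncard_supp_bubble (G.bubble x)]
  congr 1
  ext y
  refine and_iff_right_of_imp fun hy => ?_
  exact G.mem_of_mk_eq_mk (fun c hc => hS c (by rintro rfl; revert hc; decide)) hx hy

/-- The face of color `i` that contains a vertex. -/
def face (G : TetraGraph V) (i : Fin 4) (x : V) : G.Face i :=
  (G.keep {0, i}).connectedComponentMk x

@[simp]
theorem face_nbr_zero (G : TetraGraph V) (i : Fin 4) (x : V) :
    G.face i (G.nbr 0 x) = G.face i x :=
  G.mk_nbr (by simp) x

@[simp]
theorem face_nbr_self (G : TetraGraph V) (i : Fin 4) (x : V) :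
    G.face i (G.nbr i x) = G.face i x :=
  G.mk_nbr (by simp) x

theorem face_nbr_eq_face_nbr (G : TetraGraph V) (h : IsColorTriple i j k) (x : V) :
    G.face k (G.nbr i x) = G.face k (G.nbr j x) := by
  rw [← G.nbr_mul h.swap.rotate.rotate, face_nbr_self]

theorem two_mul_faceLength [Finite V] (G : TetraGraph V) (f : G.Face i) :
    2 * G.faceLength f = f.supp.ncard :=
  G.two_mul_ncard_edges_within fun x hx => (G.face_nbr_zero i x).trans hx

theorem sum_faceLength [Finite V] (G : TetraGraph V) (i : Fin 4) [Fintype (G.Face i)] :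
    ∑ f : G.Face i, G.faceLength f = 2 * Nat.card G.Bubble := by
  have hsum : Nat.card V = ∑ f : G.Face i, f.supp.ncard := by
    rw [← Nat.card_congr (Equiv.sigmaFiberEquiv (G.face i)), Nat.card_sigma]
    rfl
  simp only [← two_mul_faceLength, ← Finset.mul_sum] at hsum
  have := G.card_eq_four_mul_card_bubble
  omega

theorem jacketGenus_eq [Finite V] (G : TetraGraph V) (h : IsColorTriple i j k) :
    G.jacketGenus k = (2 + (Nat.card G.Bubble : ℚ) -
      Nat.card (G.Face i) - Nat.card (G.Face j)) / 2 := by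
  have hcard := G.card_eq_four_mul_card_bubble
  have hedges : G.jacketEdges k = 6 * Nat.card G.Bubble := by
    have (c : Fin 4) : (G.edges c).ncard = 2 * Nat.card G.Bubble := by
      have := G.two_mul_ncard_edges c
      omega
    simp [jacketEdges, this]
    ring
  have hsquares : Nat.card (G.keep {i, j}).ConnectedComponent = Nat.card G.Bubble := by
    have hmem : (0 : Fin 4) ∉ ({i, j} : Finset (Fin 4)) := by
      simp [h.fst_ne_zero.symm, h.snd_ne_zero.symm]
    have := card_eq_mul_card_component _ 4
      (G.ncard_supp_eq_four h hmem (by simp) (by simp))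
    omega
  have hfaces : G.jacketFaces k =
      Nat.card (G.Face i) + Nat.card (G.Face j) + Nat.card G.Bubble := by
    obtain ⟨hS, hi, hj⟩ : (Finset.univ.erase k).powersetCard 2 = {{0, i}, {0, j}, {i, j}} ∧
        ({0, i} : Finset (Fin 4)) ∉ ({{0, j}, {i, j}} : Finset (Finset (Fin 4))) ∧
        ({0, j} : Finset (Fin 4)) ∉ ({{i, j}} : Finset (Finset (Fin 4))) := by
      rcases h.cases with ⟨rfl, rfl, rfl⟩ | ⟨rfl, rfl, rfl⟩ | ⟨rfl, rfl, rfl⟩ |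
        ⟨rfl, rfl, rfl⟩ | ⟨rfl, rfl, rfl⟩ | ⟨rfl, rfl, rfl⟩ <;> decide
    rw [jacketFaces, hS, Finset.sum_insert hi, Finset.sum_insert hj, Finset.sum_singleton,
      hsquares, add_assoc]
  rw [jacketGenus, hedges, hfaces, hcard]
  push_cast
  ring

theorem card_face_add_card_face [Finite V] (G : TetraGraph V) (h : IsColorTriple i j k)
    (hplanar : G.jacketGenus k = 0) :
    Nat.card (G.Face i) + Nat.card (G.Face j) = Nat.card G.Bubble + 2 := by
  rw [G.jacketGenus_eq h] at hplanar
  have : (Nat.card (G.Face i) + Nat.card (G.Face j) : ℚ) = Nat.card G.Bubble + 2 := by linarith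
  exact_mod_cast this

/-! ### The cycle space over the field with two elements -/

/-- The functions on the vertices, modulo two, that are invariant under the involutions `nbr c`
for `c ∈ S`. -/
def invariants (G : TetraGraph V) (S : Finset (Fin 4)) : Submodule (ZMod 2) (V → ZMod 2) where
  carrier := {x | ∀ c ∈ S, ∀ v, x (G.nbr c v) = x v}
  add_mem' hx hy c hc v := by simp [hx c hc v, hy c hc v]
  zero_mem' _ _ _ := rfl
  smul_mem' a x hx c hc v := by simp [hx c hc v]

theorem invariants_anti (G : TetraGraph V) {S T : Finset (Fin 4)} (h : S ⊆ T) :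
    G.invariants T ≤ G.invariants S :=
  fun _ hx c hc => hx c (h hc)

theorem invariants_inf (G : TetraGraph V) (S T : Finset (Fin 4)) :
    G.invariants S ⊓ G.invariants T = G.invariants (S ∪ T) := by
  refine le_antisymm (fun x hx c hc => ?_) (le_inf (G.invariants_anti Finset.subset_union_left)
    (G.invariants_anti Finset.subset_union_right))
  rcases Finset.mem_union.1 hc with hc | hc
  exacts [hx.1 c hc, hx.2 c hc]

/-- An invariant function is a function on the connected components. -/
def invariantsEquiv (G : TetraGraph V) (S : Finset (Fin 4)) :
    ((G.keep S).ConnectedComponent → ZMod 2) ≃ₗ[ZMod 2] G.invariants S where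
  toFun y := ⟨fun v => y ((G.keep S).connectedComponentMk v),
    fun c hc v => congrArg y (G.mk_nbr hc v)⟩
  map_add' _ _ := rfl
  map_smul' _ _ := rfl
  invFun x C := C.lift x.1 fun v w p _ =>
    G.mem_of_mk_eq_mk (T := {v | x.1 v = x.1 w}) (fun c hc v hv => (x.2 c hc v).trans hv) rfl
      (SimpleGraph.ConnectedComponent.sound ⟨p⟩)
  left_inv y := by
    funext C
    induction C using SimpleGraph.ConnectedComponent.ind with
    | h v => rfl
  right_inv x := rfl

theorem finrank_invariants [Finite V] (G : TetraGraph V) (S : Finset (Fin 4)) :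
    Module.finrank (ZMod 2) (G.invariants S) = Nat.card (G.keep S).ConnectedComponent := by
  have := Fintype.ofFinite (G.keep S).ConnectedComponent
  rw [← (G.invariantsEquiv S).finrank_eq, Module.finrank_fintype_fun_eq_card,
    Nat.card_eq_fintype_card]

theorem finrank_invariants_singleton [Finite V] (G : TetraGraph V) (c : Fin 4) :
    Module.finrank (ZMod 2) (G.invariants {c}) = 2 * Nat.card G.Bubble := by
  have hpair (C : (G.keep {c}).ConnectedComponent) : C.supp.ncard = 2 := by
    obtain ⟨x, rfl⟩ := C.exists_rep
    rw [← Set.ncard_pair (G.nbr_ne c x).symm]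
    congr 1
    ext y
    refine ⟨G.mem_of_mk_eq_mk ?_ (by simp), ?_⟩
    · rintro d hd y (rfl | rfl) <;> obtain rfl := Finset.mem_singleton.1 hd <;> simp [G.nbr_nbr]
    · rintro (rfl | rfl)
      exacts [rfl, G.mk_nbr (by simp) x]
  have := card_eq_mul_card_component _ 2 hpair
  have := G.card_eq_four_mul_card_bubble
  rw [finrank_invariants]
  omega

theorem IsConnected.finrank_invariants_eq_one [Finite V] {G : TetraGraph V} (hG : G.IsConnected)
    (h : IsColorTriple i j k) {S : Finset (Fin 4)} (h0 : 0 ∈ S) (hi : i ∈ S) (hj : j ∈ S) :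
    Module.finrank (ZMod 2) (G.invariants S) = 1 := by
  have hS : G.invariants S = G.invariants Finset.univ := by
    refine le_antisymm (fun x hx c _ v => ?_) (G.invariants_anti (Finset.subset_univ S))
    rcases h.eq_or c with rfl | rfl | rfl | rfl
    · exact hx _ h0 v
    · exact hx _ hi v
    · exact hx _ hj v
    · rw [← G.nbr_mul h, hx _ hi, hx _ hj]
  obtain ⟨v⟩ := hG.nonempty
  rw [hS, finrank_invariants, Nat.card_eq_one_iff_unique]
  exact ⟨hG.preconnected.subsingleton_connectedComponent, ⟨SimpleGraph.connectedComponentMk _ v⟩⟩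

/-- The cycle space of the graph whose vertices are the bubbles and whose edges are the edges of
color `0`. An edge set is encoded by its indicator function on the half-edges, which is invariant
under `nbr 0`; the orthogonality to `G.invariants {1, 2, 3}` says that it meets every bubble an
even number of times. -/
def cycleSpace [Fintype V] (G : TetraGraph V) : Submodule (ZMod 2) (V → ZMod 2) :=
  LinearMap.BilinForm.orthogonal (dotProductBilin (ZMod 2) (ZMod 2))
    (G.invariants {0} ⊔ G.invariants {1, 2, 3})

theorem dotProduct_eq_zero [Fintype V] (G : TetraGraph V) {S T : Finset (Fin 4)} {c : Fin 4}
    (hS : c ∈ S) (hT : c ∈ T) {x y : V → ZMod 2} (hx : x ∈ G.invariants S)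
    (hy : y ∈ G.invariants T) : x ⬝ᵥ y = 0 := by
  refine Finset.sum_involution (fun v _ => G.nbr c v) (fun v _ => ?_) (fun v _ _ => G.nbr_ne c v)
    (fun _ _ => Finset.mem_univ _) (fun v _ => G.nbr_nbr c v)
  rw [hx c hS, hy c hT, CharTwo.add_self_eq_zero]

theorem mem_cycleSpace [Fintype V] (G : TetraGraph V) {c d : Fin 4} (hc : c ≠ 0) (hd : d ≠ 0)
    {z : V → ZMod 2} (hz : z ∈ G.invariants {0}) (hz' : z ∈ G.invariants {c} ⊔ G.invariants {d}) :
    z ∈ G.cycleSpace := by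
  have hmem : ∀ c : Fin 4, c ≠ 0 → c ∈ ({1, 2, 3} : Finset (Fin 4)) := by decide
  rw [cycleSpace, LinearMap.BilinForm.mem_orthogonal_iff]
  intro w hw
  obtain ⟨x, hx, y, hy, rfl⟩ := Submodule.mem_sup.1 hw
  obtain ⟨s, hs, t, ht, rfl⟩ := Submodule.mem_sup.1 hz'
  change (x + y) ⬝ᵥ (s + t) = 0
  rw [add_dotProduct, G.dotProduct_eq_zero (c := 0) (by simp) (by simp) hx hz, dotProduct_add,
    G.dotProduct_eq_zero (hmem c hc) (by simp) hy hs,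
    G.dotProduct_eq_zero (hmem d hd) (by simp) hy ht, add_zero, add_zero]

theorem IsConnected.finrank_cycleSpace [Fintype V] {G : TetraGraph V} (hG : G.IsConnected) :
    Module.finrank (ZMod 2) G.cycleSpace = Nat.card G.Bubble + 1 := by
  have hnondeg : LinearMap.BilinForm.Nondegenerate
      (dotProductBilin (m := V) (ZMod 2) (ZMod 2)) :=
    ⟨fun x hx => dotProduct_eq_zero_iff.1 hx,
      fun x hx => dotProduct_eq_zero_iff.1 fun y => (dotProduct_comm x y).trans (hx y)⟩
  have hsup := Submodule.finrank_sup_add_finrank_inf_eq (G.invariants {0}) (G.invariants {1, 2, 3})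
  rw [invariants_inf, hG.finrank_invariants_eq_one isColorTriple_one_two_three (by decide)
    (by decide) (by decide), finrank_invariants_singleton, finrank_invariants] at hsup
  change _ = _ + Nat.card G.Bubble at hsup
  have : 0 < Nat.card G.Bubble := by
    obtain ⟨v⟩ := hG.nonempty
    have : Nonempty G.Bubble := ⟨G.bubble v⟩
    exact Nat.card_pos
  rw [cycleSpace, LinearMap.BilinForm.finrank_orthogonal hnondeg,
    Module.finrank_fintype_fun_eq_card, ← Nat.card_eq_fintype_card, card_eq_four_mul_card_bubble G]
  omega

theorem sup_invariants_le_cycleSpace [Fintype V] (G : TetraGraph V) (hi : i ≠ 0) (hj : j ≠ 0) :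
    G.invariants {0, i} ⊔ G.invariants {0, j} ≤ G.cycleSpace :=
  sup_le
    (fun _ hx => G.mem_cycleSpace hi hi (G.invariants_anti (by simp) hx)
      (Submodule.mem_sup_left (G.invariants_anti (by simp) hx)))
    (fun _ hx => G.mem_cycleSpace hj hj (G.invariants_anti (by simp) hx)
      (Submodule.mem_sup_left (G.invariants_anti (by simp) hx)))

theorem IsConnected.finrank_sup_invariants [Finite V] {G : TetraGraph V} (hG : G.IsConnected)
    (h : IsColorTriple i j k) :
    Module.finrank (ZMod 2) ↥(G.invariants {0, i} ⊔ G.invariants {0, j}) + 1 =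
      Nat.card (G.Face i) + Nat.card (G.Face j) := by
  have hdim := Submodule.finrank_sup_add_finrank_inf_eq (G.invariants {0, i}) (G.invariants {0, j})
  rwa [invariants_inf, hG.finrank_invariants_eq_one h (by simp) (by simp) (by simp),
    finrank_invariants, finrank_invariants] at hdim

theorem IsConnected.exists_jacketGenus_eq_half [Finite V] {G : TetraGraph V} (hG : G.IsConnected)
    (h : IsColorTriple i j k) : ∃ m : ℕ, G.jacketGenus k = m / 2 := by
  have := Fintype.ofFinite V
  have hle := Submodule.finrank_mono (G.sup_invariants_le_cycleSpace h.fst_ne_zero h.snd_ne_zero)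
  have hfaces := hG.finrank_sup_invariants h
  rw [hG.finrank_cycleSpace] at hle
  obtain ⟨m, hm⟩ : ∃ m, 2 + Nat.card G.Bubble = Nat.card (G.Face i) + Nat.card (G.Face j) + m :=
    exists_add_of_le (by omega)
  refine ⟨m, ?_⟩
  rw [G.jacketGenus_eq h]
  have : (2 + Nat.card G.Bubble : ℚ) = Nat.card (G.Face i) + Nat.card (G.Face j) + m := by
    exact_mod_cast hm
  linarith

theorem IsConnected.cycleSpace_eq_of_planar [Fintype V] {G : TetraGraph V} (hG : G.IsConnected)
    (h : IsColorTriple i j k) (hplanar : G.jacketGenus k = 0) :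
    G.cycleSpace = G.invariants {0, i} ⊔ G.invariants {0, j} := by
  refine (Submodule.eq_of_le_of_finrank_eq
    (G.sup_invariants_le_cycleSpace h.fst_ne_zero h.snd_ne_zero) ?_).symm
  have hfaces := hG.finrank_sup_invariants h
  have := G.card_face_add_card_face h hplanar
  rw [hG.finrank_cycleSpace]
  omega

/-! ### Intersection parity in a planar jacket -/

theorem even_ncard_diff_preimage [Finite V] (G : TetraGraph V) {b c : Fin 4} {X : Set V}
    (hX : ∀ v ∈ X, G.nbr b v ∈ X) : Even (X \ G.nbr c ⁻¹' X).ncard := by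
  have hinter : Even (X ∩ G.nbr c ⁻¹' X).ncard :=
    G.even_ncard (c := c) fun v ⟨hv, hcv⟩ => ⟨hcv, by rwa [Set.mem_preimage, G.nbr_nbr]⟩
  have hsum := Set.ncard_inter_add_ncard_sdiff_eq_ncard X (G.nbr c ⁻¹' X)
  have hX := G.even_ncard hX
  rw [← hsum, Nat.even_add] at hX
  exact hX.1 hinter

/-- The cycle `z` and the loops in `𝒟` have an even number of crossings; each of them is counted
twice here. -/
theorem IsConnected.four_dvd_ncard_crossing [Fintype V] {G : TetraGraph V} (hG : G.IsConnected)
    (h : IsColorTriple i j k) (hplanar : G.jacketGenus k = 0) {z : V → ZMod 2}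
    (hz : z ∈ G.cycleSpace) {𝒟 : Set (G.Face k)} (hz𝒟 : ∀ v, G.face k v ∈ 𝒟 → z v = 0) :
    4 ∣ {v | G.face k v ∈ 𝒟 ∧ z (G.nbr j v) = 1}.ncard := by
  rw [hG.cycleSpace_eq_of_planar h hplanar] at hz
  obtain ⟨x, hx, y, hy, rfl⟩ := Submodule.mem_sup.1 hz
  set X : Set V := {v | G.face k v ∈ 𝒟 ∧ x v = 1} with hX
  set Y := X \ G.nbr k ⁻¹' X with hY
  have hz_nbr (v : V) (hv : G.face k v ∈ 𝒟) : (x + y) (G.nbr j v) = x (G.nbr k v) + x v := by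
    rw [← G.nbr_mul h, hx i (by simp), Pi.add_apply, hy j (by simp),
      CharTwo.add_eq_zero.1 (hz𝒟 v hv)]
  have hcrossing : {v | G.face k v ∈ 𝒟 ∧ (x + y) (G.nbr j v) = 1} = Y ∪ G.nbr k ⁻¹' Y := by
    ext v
    by_cases hv : G.face k v ∈ 𝒟
    · have hadd : ∀ a b : ZMod 2, a + b = 1 ↔ b = 1 ∧ a ≠ 1 ∨ a = 1 ∧ b ≠ 1 := by decide
      rw [Set.mem_ofPred_eq, hz_nbr v hv, hadd]
      simp [hX, hY, hv, G.nbr_nbr]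
    · simp [hX, hY, hv]
  have hdisj : Disjoint Y (G.nbr k ⁻¹' Y) :=
    Set.disjoint_left.2 fun v hv hkv => hv.2 hkv.1
  have hpreimage : (G.nbr k ⁻¹' Y).ncard = Y.ncard :=
    Set.ncard_preimage_of_injective_subset_range (G.nbr_injective k) fun v _ =>
      ⟨G.nbr k v, G.nbr_nbr k v⟩
  have heven : Even Y.ncard := G.even_ncard_diff_preimage (b := 0) fun v ⟨hv, hxv⟩ =>
    ⟨by rwa [face_nbr_zero], (hx 0 (by simp) v).trans hxv⟩
  rw [hcrossing, Set.ncard_union_eq hdisj, hpreimage]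
  obtain ⟨m, hm⟩ := heven
  omega

theorem IsConnected.four_dvd_ncard_crossing_face [Finite V] {G : TetraGraph V}
    (hG : G.IsConnected) (h : IsColorTriple i j k) (hplanar : G.jacketGenus k = 0)
    {𝒟 : Set (G.Face k)} {f : G.Face k} (hf : f ∉ 𝒟) :
    4 ∣ {v | G.face k v ∈ 𝒟 ∧ G.face k (G.nbr j v) = f}.ncard := by
  classical
  have := Fintype.ofFinite V
  set z : V → ZMod 2 := fun v => if G.face k v = f then 1 else 0 with hz
  have hz0 : z ∈ G.invariants {0} := fun c hc v => by
    obtain rfl := Finset.mem_singleton.1 hc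
    simp [hz]
  have hzk : z ∈ G.invariants {k} := fun c hc v => by
    obtain rfl := Finset.mem_singleton.1 hc
    simp [hz]
  have hcycle := G.mem_cycleSpace h.thd_ne_zero h.thd_ne_zero hz0 (Submodule.mem_sup_left hzk)
  have hz𝒟 (v : V) (hv : G.face k v ∈ 𝒟) : z v = 0 :=
    if_neg fun hvf : G.face k v = f => hf (hvf ▸ hv)
  have hiff (v : V) : z v = 1 ↔ G.face k v = f := by simp [hz]
  simpa only [hiff] using hG.four_dvd_ncard_crossing h hplanar hcycle hz𝒟

theorem IsConnected.even_faceLength [Finite V] {G : TetraGraph V} (hG : G.IsConnected)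
    (h : IsColorTriple i j k) (hplanar : G.jacketGenus k = 0) (f : G.Face k) :
    Even (G.faceLength f) := by
  have hself : 4 ∣ (f.supp ∩ {v | G.face k (G.nbr j v) = f}).ncard := by
    refine G.four_dvd_ncard fun c hc v ⟨hv, hjv⟩ => ?_
    change G.face k v = f at hv
    change G.face k (G.nbr j v) = f at hjv
    have hiv := (G.face_nbr_eq_face_nbr h v).trans hjv
    change G.face k (G.nbr c v) = f ∧ G.face k (G.nbr j (G.nbr c v)) = f
    rcases h.eq_or c with rfl | rfl | rfl | rfl
    · exact absurd rfl hc
    · exact ⟨hiv, by rw [G.nbr_mul h.swap, face_nbr_self, hv]⟩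
    · exact ⟨hjv, by rw [G.nbr_nbr, hv]⟩
    · exact ⟨by rw [face_nbr_self, hv], by rw [G.nbr_mul h.rotate, hiv]⟩
  have hcross : 4 ∣ (f.supp \ {v | G.face k (G.nbr j v) = f}).ncard := by
    have := hG.four_dvd_ncard_crossing_face h hplanar (Set.notMem_compl_iff.2 (Set.mem_singleton f))
    rw [← Set.ncard_image_of_injective _ (G.nbr_injective j)] at this
    convert this using 2
    ext v
    constructor
    · rintro ⟨hv, hjv⟩
      exact ⟨G.nbr j v, ⟨hjv, by rwa [G.nbr_nbr]⟩, G.nbr_nbr j v⟩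
    · rintro ⟨w, ⟨hw, hjw⟩, rfl⟩
      exact ⟨hjw, by rwa [Set.mem_ofPred_eq, G.nbr_nbr]⟩
  have hsum := Set.ncard_inter_add_ncard_sdiff_eq_ncard f.supp {v | G.face k (G.nbr j v) = f}
  rw [← G.two_mul_faceLength] at hsum
  rw [even_iff_two_dvd]
  omega

theorem single_add_single_mem_invariants [DecidableEq V] (G : TetraGraph V) (c : Fin 4) (a : V) :
    Pi.single a 1 + Pi.single (G.nbr c a) 1 ∈ G.invariants {c} := by
  intro d hd v
  obtain rfl := Finset.mem_singleton.1 hd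
  simp only [Pi.add_apply, Pi.single_apply, G.nbr_eq_iff, G.nbr_nbr]
  exact add_comm _ _

theorem exists_petal_mem_cycleSpace [Fintype V] (G : TetraGraph V) (hj : j ≠ 0) (hk : k ≠ 0)
    (hjk : j ≠ k) {v : V} (hv : G.nbr j (G.nbr 0 v) = G.nbr 0 (G.nbr k v)) :
    ∃ z ∈ G.cycleSpace, z v = 1 ∧
      ∀ w, z w ≠ 0 → w = v ∨ w = G.nbr 0 v ∨ w = G.nbr k v ∨ w = G.nbr 0 (G.nbr k v) := by
  classical
  set z : V → ZMod 2 := Pi.single v 1 + Pi.single (G.nbr 0 v) 1 +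
    (Pi.single (G.nbr k v) 1 + Pi.single (G.nbr 0 (G.nbr k v)) 1) with hz
  refine ⟨z, G.mem_cycleSpace hj hk ?_ (Submodule.mem_sup.2 ⟨_,
    G.single_add_single_mem_invariants j (G.nbr 0 v), _,
    G.single_add_single_mem_invariants k v, ?_⟩), ?_, fun w hw => ?_⟩
  · exact add_mem (G.single_add_single_mem_invariants 0 v)
      (G.single_add_single_mem_invariants 0 (G.nbr k v))
  · rw [hz, hv]
    abel
  · have hne : v ≠ G.nbr 0 (G.nbr k v) := fun hvk => by
      rw [← hvk, G.nbr_eq_iff] at hv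
      exact G.nbr_ne_nbr hj hk hjk v (hv.symm.trans (G.nbr_eq_iff.2 hvk))
    simp [hz, hne, (G.nbr_ne _ v).symm]
  · contrapose! hw
    simp [hz, hw]

/-- If `j 0 v = 0 k v`, then the edges of color `0` at `v` and at `k v` form a cycle, which the
loops other than that of `v` can cross only at `v` and at `k v`. -/
theorem IsConnected.face_nbr_eq_of_petal [Finite V] {G : TetraGraph V} (hG : G.IsConnected)
    (h : IsColorTriple i j k) (hplanar : G.jacketGenus k = 0) {v : V}
    (hv : G.nbr j (G.nbr 0 v) = G.nbr 0 (G.nbr k v)) : G.face k (G.nbr j v) = G.face k v := by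
  have := Fintype.ofFinite V
  by_contra hne
  obtain ⟨z, hz, hzv, hsupp⟩ :=
    G.exists_petal_mem_cycleSpace h.snd_ne_zero h.thd_ne_zero h.snd_ne_thd hv
  set C : Set V := {w | G.face k w ∈ ({G.face k v}ᶜ : Set _) ∧ z (G.nbr j w) = 1} with hC
  have hdvd : 4 ∣ C.ncard := hG.four_dvd_ncard_crossing h hplanar hz fun w hw => by
    by_contra hzw
    rcases hsupp w hzw with rfl | rfl | rfl | rfl <;> simp at hw
  have hsub : C ⊆ {G.nbr j v, G.nbr j (G.nbr k v)} := by
    rintro w ⟨hw, hzw⟩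
    rcases hsupp (G.nbr j w) (by simp [hzw]) with hjw | hjw | hjw | hjw <;>
      rw [G.nbr_eq_iff] at hjw
    · exact Or.inl hjw
    · simp [hjw, hv] at hw
    · exact Or.inr hjw
    · simp [hjw, ← hv, G.nbr_nbr] at hw
  have hcard : C.ncard ≤ 2 := (Set.ncard_le_ncard hsub).trans
    ((Set.ncard_insert_le _ _).trans (by rw [Set.ncard_singleton]))
  have hpos : 0 < C.ncard := (Set.ncard_pos).2 ⟨G.nbr j v, hne, by rwa [G.nbr_nbr]⟩
  have := Nat.le_of_dvd hpos hdvd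
  omega

/-! ### The lengths of the faces -/

/-- Turning around a face of color `c`: the edge of color `0`, then the edge of color `c`. -/
def turn (G : TetraGraph V) (c : Fin 4) (x : V) : V := G.nbr c (G.nbr 0 x)

theorem turn_injective (G : TetraGraph V) (c : Fin 4) : Function.Injective (G.turn c) :=
  (G.nbr_injective c).comp (G.nbr_injective 0)

@[simp]
theorem face_iterate_turn (G : TetraGraph V) (c : Fin 4) (n : ℕ) (x : V) :
    G.face c ((G.turn c)^[n] x) = G.face c x := by
  induction n with
  | zero => rfl
  | succ n ih => rw [Function.iterate_succ_apply', turn, face_nbr_self, face_nbr_zero, ih]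

theorem iterate_turn_ne_nbr_zero (G : TetraGraph V) (c : Fin 4) (n : ℕ) (x : V) :
    (G.turn c)^[n] x ≠ G.nbr 0 x := by
  induction n using Nat.strong_induction_on generalizing x with
  | _ n ih =>
    match n with
    | 0 => exact (G.nbr_ne 0 x).symm
    | 1 => exact G.nbr_ne c _
    | n + 2 =>
      intro h
      have hback : G.nbr 0 x = G.turn c (G.nbr 0 (G.turn c x)) := by simp only [turn, G.nbr_nbr]
      rw [hback, Function.iterate_succ_apply', Function.iterate_succ_apply] at h
      exact ih n (by omega) _ (G.turn_injective c h)

theorem face_eq_face_iff [Finite V] (G : TetraGraph V) (c : Fin 4) {x y : V} :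
    G.face c y = G.face c x ↔ ∃ n < Function.minimalPeriod (G.turn c) x,
      y = (G.turn c)^[n] x ∨ y = G.nbr 0 ((G.turn c)^[n] x) := by
  obtain ⟨q, hq⟩ : ∃ q, Function.minimalPeriod (G.turn c) x = q + 1 :=
    Nat.exists_eq_add_one.2
      (Function.minimalPeriod_pos_of_mem_periodicPts ((G.turn_injective c).mem_periodicPts x))
  have hback (n : ℕ) : G.nbr c ((G.turn c)^[n] x) = G.nbr 0 ((G.turn c)^[n + q] x) := by
    rw [G.nbr_eq_iff, ← turn, ← Function.iterate_succ_apply' (G.turn c), Nat.succ_eq_add_one,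
      add_assoc, ← hq, Function.iterate_add_minimalPeriod_eq]
  constructor
  · intro h
    obtain ⟨n, hn⟩ : ∃ n, y = (G.turn c)^[n] x ∨ y = G.nbr 0 ((G.turn c)^[n] x) := by
      refine G.mem_of_mk_eq_mk
        (T := {y | ∃ n, y = (G.turn c)^[n] x ∨ y = G.nbr 0 ((G.turn c)^[n] x)})
        ?_ ⟨0, Or.inl rfl⟩ h
      rintro d hd z ⟨n, hn⟩
      rcases Finset.mem_insert.1 hd with rfl | hd
      · rcases hn with rfl | rfl
        exacts [⟨n, Or.inr rfl⟩, ⟨n, Or.inl (G.nbr_nbr _ _)⟩]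
      · obtain rfl := Finset.mem_singleton.1 hd
        rcases hn with rfl | rfl
        · exact ⟨n + q, Or.inr (hback n)⟩
        · exact ⟨n + 1, Or.inl (by rw [Function.iterate_succ_apply', turn])⟩
    exact ⟨n % _, Nat.mod_lt _ (by omega), by rwa [Function.iterate_mod_minimalPeriod_eq]⟩
  · rintro ⟨n, -, rfl | rfl⟩ <;> simp

theorem faceLength_face [Finite V] (G : TetraGraph V) (c : Fin 4) (x : V) :
    G.faceLength (G.face c x) = Function.minimalPeriod (G.turn c) x := by
  set p := Function.minimalPeriod (G.turn c) x with hp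
  set T : Set V := (fun n => (G.turn c)^[n] x) '' Set.Iio p with hT
  have hsupp : (G.face c x).supp = T ∪ G.nbr 0 '' T := by
    ext y
    refine (G.face_eq_face_iff c).trans ?_
    simp only [hT, ← hp, Set.mem_union, Set.mem_image, Set.mem_Iio, exists_exists_and_eq_and]
    grind
  have hdisj : Disjoint T (G.nbr 0 '' T) := by
    rw [Set.disjoint_left]
    rintro - ⟨m, -, rfl⟩ ⟨-, ⟨n, -, rfl⟩, hmn⟩
    rcases le_total m n with hle | hle <;> obtain ⟨d, rfl⟩ := Nat.exists_eq_add_of_le' hle <;>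
      simp only [Function.iterate_add_apply] at hmn
    · exact G.iterate_turn_ne_nbr_zero c d _ (G.nbr_eq_iff.1 hmn)
    · exact G.iterate_turn_ne_nbr_zero c d _ hmn.symm
  have hncard : T.ncard = p := by
    rw [hT, Function.iterate_injOn_Iio_minimalPeriod.ncard_image,
      ← Finset.coe_range, Set.ncard_coe_finset, Finset.card_range]
  have hlength := G.two_mul_faceLength (G.face c x)
  rw [hsupp, Set.ncard_union_eq hdisj, Set.ncard_image_of_injective _ (G.nbr_injective 0),
    hncard] at hlength
  omega

theorem iterate_turn_eq_self [Finite V] (G : TetraGraph V) {c : Fin 4} {x : V} {m : ℕ}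
    (h : G.faceLength (G.face c x) = m) : (G.turn c)^[m] x = x := by
  rw [← h, faceLength_face, Function.iterate_minimalPeriod]

theorem mul_card_face_eq [Finite V] (G : TetraGraph V) {c : Fin 4} {m : ℕ}
    (hm : ∀ f : G.Face c, G.faceLength f = m) :
    m * Nat.card (G.Face c) = 2 * Nat.card G.Bubble := by
  have := Fintype.ofFinite (G.Face c)
  rw [← G.sum_faceLength c, Finset.sum_congr rfl fun f _ => hm f, Finset.sum_const,
    Finset.card_univ, smul_eq_mul, Nat.card_eq_fintype_card, mul_comm]

theorem mul_card_face_le [Finite V] (G : TetraGraph V) {c : Fin 4} {m : ℕ}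
    (hm : ∀ f : G.Face c, m ≤ G.faceLength f) :
    m * Nat.card (G.Face c) ≤ 2 * Nat.card G.Bubble := by
  have := Fintype.ofFinite (G.Face c)
  rw [← G.sum_faceLength c, mul_comm, Nat.card_eq_fintype_card, ← smul_eq_mul]
  exact Finset.card_nsmul_le_sum Finset.univ G.faceLength m fun f _ => hm f

theorem faceLength_eq_of_mul_card_face [Finite V] (G : TetraGraph V) {c : Fin 4} {m : ℕ}
    (hm : ∀ f : G.Face c, m ≤ G.faceLength f)
    (hc : m * Nat.card (G.Face c) = 2 * Nat.card G.Bubble) (f : G.Face c) :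
    G.faceLength f = m := by
  have := Fintype.ofFinite (G.Face c)
  have hsum : ∑ _f : G.Face c, m = ∑ f : G.Face c, G.faceLength f := by
    rw [G.sum_faceLength, ← hc, Finset.sum_const, smul_eq_mul, Finset.card_univ,
      ← Nat.card_eq_fintype_card, mul_comm]
  exact ((Finset.sum_eq_sum_iff_of_le fun f _ => hm f).1 hsum f (Finset.mem_univ f)).symm

theorem cut_anti (G : TetraGraph V) {T T' : Set (Sym2 V)} (h : T ⊆ T') : G.cut T' ≤ G.cut T :=
  fun _ _ ⟨c, hc, hT⟩ => ⟨c, hc, fun ⟨h0, hmem⟩ => hT ⟨h0, h hmem⟩⟩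

theorem Is2PI.connected_cut [Finite V] {G : TetraGraph V} (hG : G.Is2PI)
    (hn : 1 < Nat.card G.Bubble) {e e' : Sym2 V} (he : e ∈ G.edges 0) (he' : e' ∈ G.edges 0) :
    (G.cut {e, e'}).Connected := by
  by_cases hee : e = e'
  · have hcard : 1 < (G.edges 0).ncard := by
      have := G.two_mul_ncard_edges 0
      have := G.card_eq_four_mul_card_bubble
      omega
    obtain ⟨d, hd, hde⟩ := Set.exists_ne_of_one_lt_ncard hcard e
    exact (hG e he d hd hde.symm).mono (G.cut_anti (by simp [hee]))
  · exact hG e he e' he' hee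

theorem Is2PI.bubble_nbr_zero_ne [Finite V] {G : TetraGraph V} (hG : G.Is2PI)
    (hn : 1 < Nat.card G.Bubble) (x : V) : G.bubble (G.nbr 0 x) ≠ G.bubble x := by
  intro hx
  obtain ⟨c, hc, hcx⟩ : ∃ c, c ≠ 0 ∧ G.nbr 0 x = G.nbr c x := by
    rcases (G.bubble_eq_iff isColorTriple_one_two_three).1 hx with hx | hx | hx | hx
    exacts [absurd hx (G.nbr_ne 0 x), ⟨1, by decide, hx⟩, ⟨2, by decide, hx⟩, ⟨3, by decide, hx⟩]
  obtain ⟨d, e, h⟩ := IsColorTriple.exists_of_ne_zero hc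
  have hcut := hG.connected_cut hn ⟨G.nbr d x, rfl⟩ ⟨G.nbr e x, rfl⟩
  have hclosed (y : V) : G.bubble y = G.bubble x := by
    refine mem_of_reachable (T := {y | G.bubble y = G.bubble x}) ?_ (hcut.preconnected x y) rfl
    rintro y hy - ⟨b, rfl, hb⟩
    by_cases hb0 : b = 0
    · subst hb0
      rcases (G.bubble_eq_iff h).1 hy with rfl | rfl | rfl | rfl
      · exact hx
      · rw [← hcx, G.nbr_nbr]
        rfl
      · exact absurd ⟨rfl, Or.inl rfl⟩ hb
      · exact absurd ⟨rfl, Or.inr rfl⟩ hb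
    · exact (G.bubble_nbr hb0 y).trans hy
  have := Finite.one_lt_card_iff_nontrivial.1 hn
  obtain ⟨B, hB⟩ := exists_ne (G.bubble x)
  obtain ⟨y, rfl⟩ := B.exists_rep
  exact hB (hclosed y)

theorem Is2PI.three_le_faceLength [Finite V] {G : TetraGraph V} (hG : G.Is2PI)
    (hdipole : G.DipoleFree) (hn : 1 < Nat.card G.Bubble) {c : Fin 4} (hc : c ≠ 0)
    (f : G.Face c) : 3 ≤ G.faceLength f := by
  obtain ⟨x, rfl⟩ : ∃ x, G.face c x = f := f.exists_rep
  have hpos : 0 < G.faceLength (G.face c x) := by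
    rw [faceLength_face]
    exact Function.minimalPeriod_pos_of_mem_periodicPts ((G.turn_injective c).mem_periodicPts x)
  have hone : G.faceLength (G.face c x) ≠ 1 := fun h => by
    have hx : G.nbr c (G.nbr 0 x) = x := G.iterate_turn_eq_self h
    rw [G.nbr_eq_iff] at hx
    exact hG.bubble_nbr_zero_ne hn x (by rw [hx, G.bubble_nbr hc])
  have htwo : G.faceLength (G.face c x) ≠ 2 := fun h =>
    hdipole c hc ⟨G.face c x, h, G.nbr 0 x, G.face_nbr_zero c x, x, rfl, hG.bubble_nbr_zero_ne hn x⟩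
  omega

/-! ### Loops on the sphere -/

theorem degree_eq (G : TetraGraph V) (h : IsColorTriple i j k) :
    G.degree = G.jacketGenus i + G.jacketGenus j + G.jacketGenus k := by
  rcases h.cases with ⟨rfl, rfl, rfl⟩ | ⟨rfl, rfl, rfl⟩ | ⟨rfl, rfl, rfl⟩ | ⟨rfl, rfl, rfl⟩ |
    ⟨rfl, rfl, rfl⟩ | ⟨rfl, rfl, rfl⟩ <;> rw [degree] <;> ring

/-- The graph is connected, 2PI, dipole-free and of degree one, and its jacket `J k` is planar.
The faces of color `k` then are closed curves on the sphere, the *loops*, which cross at the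
bubbles. -/
structure IsPlanarDegreeOne (G : TetraGraph V) (i j k : Fin 4) : Prop where
  triple : IsColorTriple i j k
  connected : G.IsConnected
  twoPI : G.Is2PI
  dipoleFree : G.DipoleFree
  degree : G.degree = 1
  planar : G.jacketGenus k = 0

/-- The loops `A` and `B` cross at some bubble, where an edge of color `j` joins them; `j` may be
either of the two colors other than `0` and `k`. -/
def Crosses (G : TetraGraph V) (j : Fin 4) (A B : G.Face k) : Prop :=
  ∃ v, G.face k v = A ∧ G.face k (G.nbr j v) = B

theorem Crosses.symm {G : TetraGraph V} {A B : G.Face k} (h : G.Crosses j A B) :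
    G.Crosses j B A := by
  obtain ⟨v, hA, hB⟩ := h
  exact ⟨G.nbr j v, hB, by rwa [G.nbr_nbr]⟩

namespace IsPlanarDegreeOne

variable {G : TetraGraph V}

theorem swap (P : IsPlanarDegreeOne G i j k) : IsPlanarDegreeOne G j i k :=
  { P with triple := P.triple.swap }

theorem crosses_turn (P : IsPlanarDegreeOne G i j k) (x : V) :
    G.Crosses j (G.face k x) (G.face k (G.turn i x)) :=
  ⟨G.nbr 0 x, G.face_nbr_zero k x, (G.face_nbr_eq_face_nbr P.triple _).symm⟩

variable [Finite V]

theorem two_mul_card_face (P : IsPlanarDegreeOne G i j k) :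
    2 * Nat.card (G.Face k) = Nat.card G.Bubble := by
  have hk := P.planar
  have hdegree := P.degree
  rw [G.degree_eq P.triple] at hdegree
  rw [G.jacketGenus_eq P.triple] at hk hdegree
  rw [G.jacketGenus_eq P.triple.rotate, G.jacketGenus_eq P.triple.rotate.rotate] at hdegree
  have : (2 * Nat.card (G.Face k) : ℚ) = Nat.card G.Bubble := by linarith
  exact_mod_cast this

theorem one_lt_card_bubble (P : IsPlanarDegreeOne G i j k) : 1 < Nat.card G.Bubble := by
  obtain ⟨x⟩ := P.connected.nonempty
  have : Nonempty G.Bubble := ⟨G.bubble x⟩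
  have hpos : 0 < Nat.card G.Bubble := Nat.card_pos
  have := P.two_mul_card_face
  omega

theorem bubble_nbr_zero_ne (P : IsPlanarDegreeOne G i j k) (x : V) :
    G.bubble (G.nbr 0 x) ≠ G.bubble x :=
  P.twoPI.bubble_nbr_zero_ne P.one_lt_card_bubble x

theorem three_le_faceLength (P : IsPlanarDegreeOne G i j k) {c : Fin 4} (hc : c ≠ 0)
    (f : G.Face c) : 3 ≤ G.faceLength f :=
  P.twoPI.three_le_faceLength P.dipoleFree P.one_lt_card_bubble hc f

theorem six_le_card_bubble (P : IsPlanarDegreeOne G i j k) : 6 ≤ Nat.card G.Bubble := by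
  have hi := G.mul_card_face_le (P.three_le_faceLength P.triple.fst_ne_zero)
  have hj := G.mul_card_face_le (P.three_le_faceLength P.triple.snd_ne_zero)
  have := G.card_face_add_card_face P.triple P.planar
  omega

theorem faceLength_eq_four (P : IsPlanarDegreeOne G i j k) (f : G.Face k) :
    G.faceLength f = 4 := by
  refine G.faceLength_eq_of_mul_card_face (fun f => ?_) (by have := P.two_mul_card_face; omega) f
  obtain ⟨m, hm⟩ := P.connected.even_faceLength P.triple P.planar f
  have := P.three_le_faceLength P.triple.thd_ne_zero f
  omega

/-- In four steps a loop can return to the bubble of `v` only after the second one, so that a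
self-crossing at `v` makes the edge of color `0` at `v` part of a petal. -/
theorem face_nbr_nbr_zero_eq (P : IsPlanarDegreeOne G i j k) {v : V}
    (hv : G.face k (G.nbr j v) = G.face k v) :
    G.face k (G.nbr j (G.nbr 0 v)) = G.face k v := by
  have h := P.triple
  have hperiod := G.iterate_turn_eq_self (P.faceLength_eq_four (G.face k v))
  simp only [Function.iterate_succ_apply, Function.iterate_zero_apply, turn] at hperiod
  have hcross {x : V} (hx : G.bubble x = G.bubble v) : G.bubble (G.nbr 0 x) ≠ G.bubble v :=
    hx ▸ P.bubble_nbr_zero_ne x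
  have hbub {c : Fin 4} (hc : c ≠ 0) := G.bubble_nbr hc v
  obtain ⟨n, hn, hjv⟩ := (G.face_eq_face_iff k).1 hv
  rw [← faceLength_face, P.faceLength_eq_four] at hn
  interval_cases n <;>
    simp only [Function.iterate_succ_apply, Function.iterate_zero_apply, turn] at hjv <;>
    rcases hjv with hjv | hjv
  · exact absurd hjv (G.nbr_ne j v)
  · exact absurd (hjv ▸ hbub h.snd_ne_zero) (hcross rfl)
  · have hback := hjv ▸ hbub h.snd_ne_zero
    exact absurd (by rwa [G.bubble_nbr h.thd_ne_zero] at hback) (hcross rfl)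
  · rw [← G.face_nbr_zero k v]
    exact P.connected.face_nbr_eq_of_petal h P.planar (by rwa [G.nbr_nbr])
  · rw [← G.face_nbr_zero k v, ← G.face_nbr_eq_face_nbr h]
    refine P.connected.face_nbr_eq_of_petal h.swap P.planar ?_
    rw [G.nbr_nbr, ← G.nbr_mul h.rotate.swap, hjv, G.nbr_nbr]
  · rw [← hjv, G.nbr_mul h.rotate.swap, G.nbr_eq_iff] at hperiod
    exact absurd (hperiod ▸ hbub h.thd_ne_zero) (hcross (hbub h.fst_ne_zero))
  · rw [← hjv, G.nbr_eq_iff] at hperiod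
    exact absurd (hperiod ▸ hbub h.thd_ne_zero) (hcross (hbub h.snd_ne_zero))
  · rw [← hjv, G.nbr_mul h.rotate.swap] at hperiod
    exact absurd hperiod (G.nbr_ne i v)

theorem face_nbr_ne (P : IsPlanarDegreeOne G i j k) (v : V) :
    G.face k (G.nbr j v) ≠ G.face k v := by
  intro hv
  have hall (w : V) : G.face k w = G.face k v ∧ G.face k (G.nbr j w) = G.face k v := by
    refine P.connected.mem (T := {w | G.face k w = G.face k v ∧ G.face k (G.nbr j w) = G.face k v})
      ?_ ⟨rfl, hv⟩ w
    rintro c w ⟨hw, hjw⟩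
    rcases P.triple.eq_or c with rfl | rfl | rfl | rfl
    · exact ⟨by simpa using hw, (P.face_nbr_nbr_zero_eq (hjw.trans hw.symm)).trans hw⟩
    · rw [Set.mem_ofPred_eq, G.face_nbr_eq_face_nbr P.triple, G.nbr_mul P.triple.swap]
      exact ⟨hjw, by simpa using hw⟩
    · exact ⟨hjw, by rwa [G.nbr_nbr]⟩
    · refine ⟨by simpa using hw, ?_⟩
      rwa [G.nbr_mul P.triple.rotate, G.face_nbr_eq_face_nbr P.triple]
  have hone : Nat.card (G.Face k) ≤ 1 := by
    refine Finite.card_le_one_iff_subsingleton.2 ⟨fun A B => ?_⟩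
    obtain ⟨a, rfl⟩ := A.exists_rep
    obtain ⟨b, rfl⟩ := B.exists_rep
    exact (hall a).1.trans (hall b).1.symm
  have := P.six_le_card_bubble
  have := P.two_mul_card_face
  omega

theorem four_le_ncard_of_crosses (P : IsPlanarDegreeOne G i j k) {A B : G.Face k} (hAB : A ≠ B)
    (hcross : G.Crosses j A B) : 4 ≤ {v | G.face k v = A ∧ G.face k (G.nbr j v) = B}.ncard := by
  refine Nat.le_of_dvd ((Set.ncard_pos).2 hcross) ?_
  exact P.connected.four_dvd_ncard_crossing_face P.triple P.planar (𝒟 := {A}) hAB.symm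

/-- Of the eight vertices of `A`, at least four lie at crossings with `B` and four at crossings
with `C`. -/
theorem face_nbr_eq_or (P : IsPlanarDegreeOne G i j k) {A B C : G.Face k} (hAB : A ≠ B)
    (hAC : A ≠ C) (hBC : B ≠ C) (hcrossB : G.Crosses j A B) (hcrossC : G.Crosses j A C)
    {v : V} (hv : G.face k v = A) : G.face k (G.nbr j v) = B ∨ G.face k (G.nbr j v) = C := by
  have hdisj : Disjoint {v | G.face k v = A ∧ G.face k (G.nbr j v) = B}
      {v | G.face k v = A ∧ G.face k (G.nbr j v) = C} :=
    Set.disjoint_left.2 fun v hB hC => hBC (hB.2.symm.trans hC.2)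
  have hunion : {v | G.face k v = A ∧ G.face k (G.nbr j v) = B} ∪
      {v | G.face k v = A ∧ G.face k (G.nbr j v) = C} = A.supp := by
    refine Set.eq_of_subset_of_ncard_le
      (Set.union_subset (fun v hv => hv.1) fun v hv => hv.1) ?_
    have := P.four_le_ncard_of_crosses hAB hcrossB
    have := P.four_le_ncard_of_crosses hAC hcrossC
    rw [Set.ncard_union_eq hdisj, ← G.two_mul_faceLength, P.faceLength_eq_four]
    omega
  have hmem : v ∈ A.supp := hv
  rw [← hunion] at hmem
  exact hmem.imp And.right And.right

theorem card_face_le_three_of_crosses (P : IsPlanarDegreeOne G i j k) {A B C : G.Face k}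
    (hAB : A ≠ B) (hBC : B ≠ C) (hCA : C ≠ A) (hcrossAB : G.Crosses j A B)
    (hcrossBC : G.Crosses j B C) (hcrossCA : G.Crosses j C A) : Nat.card (G.Face k) ≤ 3 := by
  obtain ⟨x, hx, -⟩ := id hcrossAB
  have hjmem (v : V) (hv : G.face k v ∈ ({A, B, C} : Set _)) :
      G.face k (G.nbr j v) ∈ ({A, B, C} : Set _) := by
    rcases hv with hv | hv | hv
    · exact Or.inr (P.face_nbr_eq_or hAB hCA.symm hBC hcrossAB hcrossCA.symm hv)
    · have := P.face_nbr_eq_or hBC hAB.symm hCA hcrossBC hcrossAB.symm hv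
      exact this.elim (fun e => Or.inr (Or.inr e)) Or.inl
    · have := P.face_nbr_eq_or hCA hBC.symm hAB hcrossCA hcrossBC.symm hv
      exact this.elim Or.inl fun e => Or.inr (Or.inl e)
  have hall (v : V) : G.face k v ∈ ({A, B, C} : Set _) := by
    refine P.connected.mem (T := {v | G.face k v ∈ ({A, B, C} : Set _)}) ?_ (Or.inl hx) v
    intro c v hv
    rw [Set.mem_ofPred_eq] at hv ⊢
    rcases P.triple.eq_or c with rfl | rfl | rfl | rfl
    · rwa [face_nbr_zero]
    · rw [G.face_nbr_eq_face_nbr P.triple]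
      exact hjmem v hv
    · exact hjmem v hv
    · rwa [face_nbr_self]
  have hsub : Set.univ ⊆ ({A, B, C} : Set (G.Face k)) := by
    rintro f -
    obtain ⟨v, rfl⟩ := f.exists_rep
    exact hall v
  rw [← Set.ncard_univ]
  have := Set.ncard_insert_le A {B, C}
  have := Set.ncard_insert_le B {C}
  have := Set.ncard_le_ncard hsub
  rw [Set.ncard_singleton] at *
  omega

theorem face_turn_ne (P : IsPlanarDegreeOne G i j k) (x : V) :
    G.face k (G.turn i x) ≠ G.face k x := by
  rw [turn, G.face_nbr_eq_face_nbr P.triple, ← G.face_nbr_zero k x]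
  exact P.face_nbr_ne (G.nbr 0 x)

/-- The three loops through a triangle of color `i` cross each other pairwise. -/
theorem card_bubble_le_six_of_faceLength_eq_three (P : IsPlanarDegreeOne G i j k) {f : G.Face i}
    (hf : G.faceLength f = 3) : Nat.card G.Bubble ≤ 6 := by
  obtain ⟨x, rfl⟩ : ∃ x, G.face i x = f := f.exists_rep
  have hx : G.turn i (G.turn i (G.turn i x)) = x := G.iterate_turn_eq_self hf
  have hne := P.face_turn_ne (G.turn i (G.turn i x))
  have hcross := P.crosses_turn (G.turn i (G.turn i x))
  rw [hx] at hne hcross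
  have := P.card_face_le_three_of_crosses (P.face_turn_ne x).symm (P.face_turn_ne _).symm hne.symm
    (P.crosses_turn x) (P.crosses_turn _) hcross
  have := P.two_mul_card_face
  omega

theorem card_bubble_eq_six (P : IsPlanarDegreeOne G i j k) : Nat.card G.Bubble = 6 := by
  refine le_antisymm ?_ P.six_le_card_bubble
  by_contra hn
  have hi (f : G.Face i) : 4 ≤ G.faceLength f :=
    lt_of_le_of_ne (P.three_le_faceLength P.triple.fst_ne_zero f)
      fun h => hn (P.card_bubble_le_six_of_faceLength_eq_three h.symm)
  have hj (f : G.Face j) : 4 ≤ G.faceLength f :=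
    lt_of_le_of_ne (P.three_le_faceLength P.triple.snd_ne_zero f)
      fun h => hn (P.swap.card_bubble_le_six_of_faceLength_eq_three h.symm)
  have := G.mul_card_face_le hi
  have := G.mul_card_face_le hj
  have := G.card_face_add_card_face P.triple P.planar
  omega

theorem iterate_turn_three (P : IsPlanarDegreeOne G i j k) (x : V) : (G.turn i)^[3] x = x := by
  have hi := G.mul_card_face_le (P.three_le_faceLength P.triple.fst_ne_zero)
  have hj := G.mul_card_face_le (P.three_le_faceLength P.triple.snd_ne_zero)
  have := G.card_face_add_card_face P.triple P.planar
  have := P.card_bubble_eq_six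
  exact G.iterate_turn_eq_self (G.faceLength_eq_of_mul_card_face
    (P.three_le_faceLength P.triple.fst_ne_zero) (by omega) (G.face i x))

end IsPlanarDegreeOne

/-! ### Triangles and the Coxeter group of type `A₃` -/

/-- Three involutions that satisfy the relations of the simple reflections in the Coxeter group of
type `A₃`, the symmetric group on four letters. -/
structure IsCoxeterTriple (p q r : V → V) : Prop where
  fst_fst : ∀ x, p (p x) = x
  snd_snd : ∀ x, q (q x) = x
  thd_thd : ∀ x, r (r x) = x
  thd_fst : ∀ x, r (p x) = p (r x)
  snd_fst_snd : ∀ x, q (p (q x)) = p (q (p x))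
  thd_snd_thd : ∀ x, r (q (r x)) = q (r (q x))

/-- The orbit of `x` under the dihedral group generated by two involutions `p` and `q` that satisfy
the braid relation. -/
def dihedralOrbit (p q : V → V) (x : V) : Set V :=
  {x, p x, q x, p (q x), q (p x), p (q (p x))}

theorem ncard_dihedralOrbit_le (p q : V → V) (x : V) : (dihedralOrbit p q x).ncard ≤ 6 := by
  classical
  have : dihedralOrbit p q x = ({x, p x, q x, p (q x), q (p x), p (q (p x))} : Finset V) := by
    simp [dihedralOrbit]
  rw [this, Set.ncard_coe_finset]
  exact Finset.card_le_six

/-- The orbit of `x` under the group generated by a Coxeter triple `p`, `q`, `r`: the union of the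
orbits under `p` and `q`, one for each coset of the dihedral subgroup. -/
def coxeterOrbit (p q r : V → V) (x : V) : Set V :=
  dihedralOrbit p q x ∪ dihedralOrbit p q (r x) ∪ dihedralOrbit p q (r (q x)) ∪
    dihedralOrbit p q (r (q (p x)))

theorem ncard_coxeterOrbit_le (p q r : V → V) (x : V) : (coxeterOrbit p q r x).ncard ≤ 24 := by
  have hx := ncard_dihedralOrbit_le p q
  calc (coxeterOrbit p q r x).ncard
      ≤ 6 + 6 + 6 + 6 :=
        (Set.ncard_union_le _ _).trans (add_le_add ((Set.ncard_union_le _ _).trans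
          (add_le_add ((Set.ncard_union_le _ _).trans (add_le_add (hx _) (hx _))) (hx _))) (hx _))
    _ = 24 := rfl

theorem self_mem_coxeterOrbit (p q r : V → V) (x : V) : x ∈ coxeterOrbit p q r x :=
  Or.inl (Or.inl (Or.inl (Or.inl rfl)))

namespace IsCoxeterTriple

variable {p q r : V → V}

theorem prodMap (h : IsCoxeterTriple p q r) {p' q' r' : W → W} (h' : IsCoxeterTriple p' q' r') :
    IsCoxeterTriple (Prod.map p p') (Prod.map q q') (Prod.map r r') where
  fst_fst x := Prod.ext (h.fst_fst x.1) (h'.fst_fst x.2)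
  snd_snd x := Prod.ext (h.snd_snd x.1) (h'.snd_snd x.2)
  thd_thd x := Prod.ext (h.thd_thd x.1) (h'.thd_thd x.2)
  thd_fst x := Prod.ext (h.thd_fst x.1) (h'.thd_fst x.2)
  snd_fst_snd x := Prod.ext (h.snd_fst_snd x.1) (h'.snd_fst_snd x.2)
  thd_snd_thd x := Prod.ext (h.thd_snd_thd x.1) (h'.thd_snd_thd x.2)

theorem fst_mem_dihedralOrbit (h : IsCoxeterTriple p q r) {x y : V}
    (hy : y ∈ dihedralOrbit p q x) : p y ∈ dihedralOrbit p q x := by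
  rcases hy with rfl | rfl | rfl | rfl | rfl | rfl <;> simp [dihedralOrbit, h.fst_fst]

theorem snd_mem_dihedralOrbit (h : IsCoxeterTriple p q r) {x y : V}
    (hy : y ∈ dihedralOrbit p q x) : q y ∈ dihedralOrbit p q x := by
  rcases hy with rfl | rfl | rfl | rfl | rfl | rfl <;>
    simp [dihedralOrbit, h.fst_fst, h.snd_snd, h.snd_fst_snd]

theorem fst_mem_coxeterOrbit (h : IsCoxeterTriple p q r) {x y : V}
    (hy : y ∈ coxeterOrbit p q r x) : p y ∈ coxeterOrbit p q r x :=
  hy.imp (Or.imp (Or.imp h.fst_mem_dihedralOrbit h.fst_mem_dihedralOrbit) h.fst_mem_dihedralOrbit)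
    h.fst_mem_dihedralOrbit

theorem snd_mem_coxeterOrbit (h : IsCoxeterTriple p q r) {x y : V}
    (hy : y ∈ coxeterOrbit p q r x) : q y ∈ coxeterOrbit p q r x :=
  hy.imp (Or.imp (Or.imp h.snd_mem_dihedralOrbit h.snd_mem_dihedralOrbit) h.snd_mem_dihedralOrbit)
    h.snd_mem_dihedralOrbit

theorem thd_mem_coxeterOrbit (h : IsCoxeterTriple p q r) {x y : V}
    (hy : y ∈ coxeterOrbit p q r x) : r y ∈ coxeterOrbit p q r x := by
  have hcomm (x : V) : r (q (p (r x))) = q (r (q (p x))) := by rw [← h.thd_fst, h.thd_snd_thd]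
  rcases hy with ((hy | hy) | hy) | hy <;> rcases hy with rfl | rfl | rfl | rfl | rfl | rfl <;>
    simp [coxeterOrbit, dihedralOrbit, h.fst_fst, h.snd_snd, h.thd_thd, h.thd_fst, h.snd_fst_snd,
      h.thd_snd_thd, hcomm]

end IsCoxeterTriple

theorem isCoxeterTriple_of_triangles (G : TetraGraph V) (h : IsColorTriple i j k)
    (hi : ∀ x, (G.turn i)^[3] x = x) (hj : ∀ x, (G.turn j)^[3] x = x) :
    IsCoxeterTriple (G.nbr i) (G.nbr 0) (G.nbr j) where
  fst_fst := G.nbr_nbr i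
  snd_snd := G.nbr_nbr 0
  thd_thd := G.nbr_nbr j
  thd_fst x := by rw [G.nbr_mul h, G.nbr_mul h.swap]
  snd_fst_snd x := by
    have hx : G.nbr i (G.nbr 0 (G.nbr i (G.nbr 0 (G.nbr i (G.nbr 0 x))))) = x := hi x
    rwa [G.nbr_eq_iff, G.nbr_eq_iff, G.nbr_eq_iff] at hx
  thd_snd_thd x := by
    have hx : G.nbr j (G.nbr 0 (G.nbr j (G.nbr 0 (G.nbr j (G.nbr 0 x))))) = x := hj x
    rw [G.nbr_eq_iff, G.nbr_eq_iff, G.nbr_eq_iff] at hx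
    exact hx.symm

theorem sameUpToColors_of_relation [Finite V] [Finite W] {G : TetraGraph V} {H : TetraGraph W}
    (hG : G.IsConnected) (hH : H.IsConnected) {π : Equiv.Perm (Fin 4)} (hπ : π 0 = 0)
    {R : Set (V × W)} (hR : R.Nonempty)
    (hclosed : ∀ c, ∀ z ∈ R, Prod.map (G.nbr c) (H.nbr (π c)) z ∈ R)
    (hV : R.ncard ≤ Nat.card V) (hW : R.ncard ≤ Nat.card W) : G.SameUpToColors H := by
  obtain ⟨z₀, hz₀⟩ := hR
  have hfst : Function.Surjective fun z : R => z.1.1 := fun x => by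
    obtain ⟨z, hz, rfl⟩ : x ∈ Prod.fst '' R := by
      refine hG.mem ?_ (Set.mem_image_of_mem _ hz₀) x
      rintro c - ⟨z, hz, rfl⟩
      exact ⟨_, hclosed c z hz, rfl⟩
    exact ⟨⟨z, hz⟩, rfl⟩
  have hsnd : Function.Surjective fun z : R => z.1.2 := fun y => by
    obtain ⟨z, hz, rfl⟩ : y ∈ Prod.snd '' R := by
      refine hH.mem ?_ (Set.mem_image_of_mem _ hz₀) y
      rintro c - ⟨z, hz, rfl⟩
      exact ⟨_, hclosed (π.symm c) z hz, by simp⟩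
    exact ⟨⟨z, hz⟩, rfl⟩
  let e₁ : R ≃ V := Equiv.ofBijective _ (hfst.bijective_of_nat_card_le hV)
  let e₂ : R ≃ W := Equiv.ofBijective _ (hsnd.bijective_of_nat_card_le hW)
  refine ⟨e₁.symm.trans e₂, π, hπ, fun c x => ?_⟩
  obtain ⟨z, rfl⟩ := e₁.surjective x
  have hnbr : G.nbr c (e₁ z) = e₁ ⟨_, hclosed c z z.2⟩ := rfl
  rw [hnbr, Equiv.trans_apply, Equiv.trans_apply, Equiv.symm_apply_apply, Equiv.symm_apply_apply]
  rfl

namespace IsColorTriple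

theorem exists_perm_eq (h : IsColorTriple i j k) :
    ∃ π : Equiv.Perm (Fin 4), π 0 = 0 ∧ π 1 = i ∧ π 2 = j ∧ π 3 = k := by
  have hinj : Function.Injective ![0, i, j, k] := by
    obtain ⟨hi, hj, hk, hij, hik, hjk⟩ := h
    revert i j k; decide
  exact ⟨Equiv.ofBijective _ hinj.bijective_of_finite, rfl, rfl, rfl, rfl⟩

theorem exists_perm {i' j' k' : Fin 4} (h : IsColorTriple i j k) (h' : IsColorTriple i' j' k') :
    ∃ π : Equiv.Perm (Fin 4), π 0 = 0 ∧ π i = i' ∧ π j = j' ∧ π k = k' := by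
  obtain ⟨σ, h0, rfl, rfl, rfl⟩ := h.exists_perm_eq
  obtain ⟨τ, h0', rfl, rfl, rfl⟩ := h'.exists_perm_eq
  refine ⟨σ.symm.trans τ, ?_, ?_, ?_, ?_⟩
  · rw [← h0, Equiv.trans_apply, Equiv.symm_apply_apply, h0', h0]
  all_goals rw [Equiv.trans_apply, Equiv.symm_apply_apply]

end IsColorTriple

theorem sameUpToColors_of_triangles [Finite V] [Finite W] {G : TetraGraph V} {H : TetraGraph W}
    (hG : G.IsConnected) (hH : H.IsConnected) {i' j' k' : Fin 4} (h : IsColorTriple i j k)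
    (h' : IsColorTriple i' j' k') (hi : ∀ x, (G.turn i)^[3] x = x)
    (hj : ∀ x, (G.turn j)^[3] x = x) (hi' : ∀ y, (H.turn i')^[3] y = y)
    (hj' : ∀ y, (H.turn j')^[3] y = y) (hV : 24 ≤ Nat.card V) (hW : 24 ≤ Nat.card W) :
    G.SameUpToColors H := by
  obtain ⟨x⟩ := hG.nonempty
  obtain ⟨y⟩ := hH.nonempty
  have hdiag := (G.isCoxeterTriple_of_triangles h hi hj).prodMap
    (H.isCoxeterTriple_of_triangles h' hi' hj')
  obtain ⟨π, hπ, rfl, rfl, rfl⟩ := h.exists_perm h'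
  have hcard := ncard_coxeterOrbit_le (Prod.map (G.nbr i) (H.nbr (π i)))
    (Prod.map (G.nbr 0) (H.nbr 0)) (Prod.map (G.nbr j) (H.nbr (π j))) (x, y)
  refine sameUpToColors_of_relation hG hH hπ ⟨_, self_mem_coxeterOrbit _ _ _ (x, y)⟩
    (fun c z hz => ?_) (hcard.trans hV) (hcard.trans hW)
  rcases h.eq_or c with rfl | rfl | rfl | rfl
  · rw [hπ]
    exact hdiag.snd_mem_coxeterOrbit hz
  · exact hdiag.fst_mem_coxeterOrbit hz
  · exact hdiag.thd_mem_coxeterOrbit hz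
  · convert hdiag.fst_mem_coxeterOrbit (hdiag.thd_mem_coxeterOrbit hz) using 1
    exact Prod.ext (G.nbr_mul h z.1).symm (H.nbr_mul h' z.2).symm

/-! ### The octahedral graph -/

set_option synthInstance.maxSize 1024 in
theorem iterate_turn_octahedralGraph_of_ne_three {c : Fin 4} (hc : c ≠ 0) (hc3 : c ≠ 3)
    (x : OctHalfEdge) : (octahedralGraph.turn c)^[3] x = x := by
  suffices ∀ c : Fin 4, c ≠ 0 → c ≠ 3 → ∀ x : OctHalfEdge,
    (octahedralGraph.turn c)^[3] x = x from this c hc hc3 x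
  decide +kernel

theorem iterate_turn_octahedralGraph_three (x : OctHalfEdge) :
    (octahedralGraph.turn 3)^[4] x = x := by
  revert x; decide +kernel

theorem turn_octahedralGraph_ne {c : Fin 4} (hc : c ≠ 0) (x : OctHalfEdge) :
    octahedralGraph.turn c x ≠ x := by
  revert c x; decide +kernel

theorem turn_turn_octahedralGraph_ne (x : OctHalfEdge) :
    octahedralGraph.turn 3 (octahedralGraph.turn 3 x) ≠ x := by
  revert x; decide +kernel

theorem faceLength_octahedralGraph_of_ne_three {c : Fin 4} (hc : c ≠ 0) (hc3 : c ≠ 3)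
    (f : octahedralGraph.Face c) : octahedralGraph.faceLength f = 3 := by
  obtain ⟨x, rfl⟩ : ∃ x, octahedralGraph.face c x = f := f.exists_rep
  have : Fact (Nat.Prime 3) := ⟨Nat.prime_three⟩
  rw [faceLength_face]
  exact Function.minimalPeriod_eq_prime (iterate_turn_octahedralGraph_of_ne_three hc hc3 x)
    (turn_octahedralGraph_ne hc x)

theorem faceLength_octahedralGraph_three (f : octahedralGraph.Face 3) :
    octahedralGraph.faceLength f = 4 := by
  obtain ⟨x, rfl⟩ : ∃ x, octahedralGraph.face 3 x = f := f.exists_rep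
  have : Fact (Nat.Prime 2) := ⟨Nat.prime_two⟩
  rw [faceLength_face]
  exact Function.minimalPeriod_eq_prime_pow (p := 2) (k := 1) (turn_turn_octahedralGraph_ne x)
    (iterate_turn_octahedralGraph_three x)

theorem dipoleFree_octahedralGraph : octahedralGraph.DipoleFree := by
  rintro c hc ⟨f, hf, -⟩
  by_cases hc3 : c = 3
  · subst hc3
    rw [faceLength_octahedralGraph_three] at hf
    omega
  · rw [faceLength_octahedralGraph_of_ne_three hc hc3] at hf
    omega

theorem card_octHalfEdge : Nat.card OctHalfEdge = 24 := by
  rw [Nat.card_eq_fintype_card]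
  decide +kernel

theorem degree_octahedralGraph : octahedralGraph.degree = 1 := by
  have hcard := octahedralGraph.card_eq_four_mul_card_bubble
  rw [card_octHalfEdge] at hcard
  have hbubble : Nat.card octahedralGraph.Bubble = 6 := by omega
  have hface {c : Fin 4} (hc : c ≠ 0) (hc3 : c ≠ 3) :
      Nat.card (octahedralGraph.Face c) = 4 := by
    have := octahedralGraph.mul_card_face_eq (faceLength_octahedralGraph_of_ne_three hc hc3)
    omega
  have hloop : Nat.card (octahedralGraph.Face 3) = 3 := by
    have := octahedralGraph.mul_card_face_eq faceLength_octahedralGraph_three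
    omega
  have h := isColorTriple_one_two_three
  rw [degree, octahedralGraph.jacketGenus_eq h, octahedralGraph.jacketGenus_eq h.rotate,
    octahedralGraph.jacketGenus_eq h.rotate.rotate, hbubble, hloop,
    hface (by decide) (by decide), hface (by decide) (by decide)]
  norm_num

theorem eq_or_of_fst_eq {x y : OctHalfEdge} (h : x.1.1 = y.1.1) :
    y = x ∨ ∃ c, y = octahedralGraph.nbr c x := by
  revert x y; decide +kernel

theorem connected_of_reachable_nbr {H : SimpleGraph OctHalfEdge}
    (hH : ∀ c x, H.Reachable x (octahedralGraph.nbr c x)) : H.Connected := by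
  have hbubble {x y : OctHalfEdge} (h : x.1.1 = y.1.1) : H.Reachable x y := by
    rcases eq_or_of_fst_eq h with rfl | ⟨c, rfl⟩
    exacts [SimpleGraph.Reachable.rfl, hH c x]
  have haxis {x y : OctHalfEdge} (h : x.1.1.1 ≠ y.1.1.1) : H.Reachable x y :=
    (hbubble (x := x) (y := ⟨(x.1.1, y.1.1), h⟩) rfl).trans ((hH 0 _).trans (hbubble (y := y) rfl))
  have : Nonempty OctHalfEdge := ⟨⟨((0, 0), (1, 0)), by decide⟩⟩
  refine ⟨fun x y => ?_⟩
  by_cases h : x.1.1.1 = y.1.1.1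
  · exact (hH 0 x).trans (haxis fun h' => x.2 (h.trans h'.symm))
  · exact haxis h

theorem isConnected_octahedralGraph : octahedralGraph.IsConnected :=
  connected_of_reachable_nbr fun c _ => SimpleGraph.Adj.reachable ⟨c, Finset.mem_univ c, rfl⟩

theorem reachable_nbr_zero_of_triangle (G : TetraGraph V) {T : Set (Sym2 V)} {c : Fin 4}
    (hc : c ≠ 0) {x : V} (hx : (G.turn c)^[3] x = x)
    (hturn : s(G.turn c x, G.nbr 0 (G.turn c x)) ∉ T)
    (hnbr : s(G.nbr c x, G.nbr 0 (G.nbr c x)) ∉ T) : (G.cut T).Reachable x (G.nbr 0 x) := by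
  have hstep (y : V) : (G.cut T).Reachable y (G.nbr c y) :=
    SimpleGraph.Adj.reachable ⟨c, rfl, fun h => hc h.1⟩
  have hcorner : G.nbr c (G.nbr 0 (G.turn c x)) = G.nbr 0 (G.nbr c x) := by
    rw [← G.nbr_eq_iff, ← G.nbr_eq_iff]
    exact hx
  have hedge : (G.cut T).Reachable (G.turn c x) (G.nbr 0 (G.turn c x)) :=
    SimpleGraph.Adj.reachable ⟨0, rfl, fun h => hturn h.2⟩
  have hedge' : (G.cut T).Reachable (G.nbr c x) (G.nbr 0 (G.nbr c x)) :=
    SimpleGraph.Adj.reachable ⟨0, rfl, fun h => hnbr h.2⟩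
  exact (hstep x).trans (hedge'.trans
    ((hcorner ▸ hstep (G.nbr 0 (G.turn c x))).symm.trans (hedge.symm.trans (hstep _).symm)))

set_option synthInstance.maxSize 1024 in
/-- Each edge of color `0` lies in two triangles, which have no other edge in common. -/
theorem exists_triangle_avoiding (x y : OctHalfEdge) : ∃ c : Fin 4, c ≠ 0 ∧ c ≠ 3 ∧
    ∀ z, z = octahedralGraph.turn c x ∨ z = octahedralGraph.nbr c x →
      s(z, octahedralGraph.nbr 0 z) ≠ s(x, octahedralGraph.nbr 0 x) ∧
      s(z, octahedralGraph.nbr 0 z) ≠ s(y, octahedralGraph.nbr 0 y) := by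
  revert x y; decide +kernel

theorem is2PI_octahedralGraph : octahedralGraph.Is2PI := by
  have hcut (x y : OctHalfEdge) : (octahedralGraph.cut
      {s(x, octahedralGraph.nbr 0 x), s(y, octahedralGraph.nbr 0 y)}).Reachable
        x (octahedralGraph.nbr 0 x) := by
    obtain ⟨c, hc, hc3, hz⟩ := exists_triangle_avoiding x y
    exact octahedralGraph.reachable_nbr_zero_of_triangle hc
      (iterate_turn_octahedralGraph_of_ne_three hc hc3 x)
      (not_or.2 (hz _ (.inl rfl))) (not_or.2 (hz _ (.inr rfl)))
  rintro _ ⟨x, rfl⟩ _ ⟨y, rfl⟩ -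
  refine connected_of_reachable_nbr fun c w => ?_
  by_cases hw : c = 0 ∧ s(w, octahedralGraph.nbr 0 w) ∈
      ({s(x, octahedralGraph.nbr 0 x), s(y, octahedralGraph.nbr 0 y)} : Set (Sym2 OctHalfEdge))
  · obtain ⟨rfl, h | h⟩ := hw
    · have := hcut w y
      rwa [h] at this
    · have := hcut w x
      rwa [Set.pair_comm, Set.mem_singleton_iff.1 h] at this
  · refine SimpleGraph.Adj.reachable ⟨c, rfl, ?_⟩
    rintro ⟨rfl, h⟩
    exact hw ⟨rfl, h⟩

theorem IsPlanarDegreeOne.sameUpToColors_octahedralGraph [Finite V] {G : TetraGraph V}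
    (P : IsPlanarDegreeOne G i j k) : G.SameUpToColors octahedralGraph :=
  sameUpToColors_of_triangles P.connected isConnected_octahedralGraph P.triple
    isColorTriple_one_two_three P.iterate_turn_three P.swap.iterate_turn_three
    (iterate_turn_octahedralGraph_of_ne_three (by decide) (by decide))
    (iterate_turn_octahedralGraph_of_ne_three (by decide) (by decide))
    (by rw [G.card_eq_four_mul_card_bubble, P.card_bubble_eq_six]) card_octHalfEdge.ge

theorem IsConnected.exists_jacketGenus_eq_zero [Finite V] {G : TetraGraph V} (hG : G.IsConnected)
    (hdegree : G.degree = 1) : ∃ i j k, IsColorTriple i j k ∧ G.jacketGenus k = 0 := by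
  have h := isColorTriple_one_two_three
  obtain ⟨a, ha⟩ := hG.exists_jacketGenus_eq_half h.rotate
  obtain ⟨b, hb⟩ := hG.exists_jacketGenus_eq_half h.rotate.rotate
  obtain ⟨c, hc⟩ := hG.exists_jacketGenus_eq_half h
  have hsum : a + b + c = 2 := by
    rw [degree, ha, hb, hc] at hdegree
    have : (a + b + c : ℚ) = 2 := by linarith
    exact_mod_cast this
  obtain rfl | rfl | rfl : a = 0 ∨ b = 0 ∨ c = 0 := by omega
  exacts [⟨_, _, _, h.rotate, by simpa using ha⟩, ⟨_, _, _, h.rotate.rotate, by simpa using hb⟩,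
    ⟨_, _, _, h, by simpa using hc⟩]

end TetraGraph

theorem theorem6p1 :
    (octahedralGraph.IsConnected ∧ octahedralGraph.Is2PI ∧ octahedralGraph.DipoleFree ∧
      octahedralGraph.degree = 1) ∧
    ∀ (V : Type u) [Finite V] (G : TetraGraph V),
      G.IsConnected → G.Is2PI → G.DipoleFree → G.degree = 1 →
        G.SameUpToColors octahedralGraph := by
  refine ⟨⟨TetraGraph.isConnected_octahedralGraph, TetraGraph.is2PI_octahedralGraph,
    TetraGraph.dipoleFree_octahedralGraph, TetraGraph.degree_octahedralGraph⟩, ?_⟩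
  intro V _ G hconnected h2PI hdipole hdegree
  obtain ⟨i, j, k, htriple, hplanar⟩ := hconnected.exists_jacketGenus_eq_zero hdegree
  exact TetraGraph.IsPlanarDegreeOne.sameUpToColors_octahedralGraph
    ⟨htriple, hconnected, h2PI, hdipole, hdegree, hplanar⟩
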